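/- Let $(M,g)$ be a smooth Riemannian manifold of dimension $n\ge 3$ with Riemann curvature tensor $R$ (with the sign for which $R(u,v;u,v)$ is the sectional curvature of the plane spanned by orthonormal vectors $u,v$), Ricci tensor $\mathrm{Ric}$ and scalar curvature $\mathrm{Scal}$. Let $$A=\frac{1}{n-2}\Bigl(\mathrm{Ric}-\frac{\mathrm{Scal}}{2(n-1)}\,g\Bigr)$$ be the Schouten tensor, and for $1\le k\le n$ let $\sigma_k$ be the $k$-th elementary symmetric function of the eigenvalues (with multiplicity) of the operator associated with $A$ via $g$. Regard $g$ as a $(1,1)$-double form and $R$ as a $(2,2)$-double form. With products taken in the algebra of double forms $\Lambda T^*M\otimes\Lambda T^*M$, where $(a\otimes b)(c\otimes d)=(a\wedge c)\otimes(b\wedge d)$, and with $\ast$ the Hodge star operator acting on both factors, define the Gauss–Bonnet curvatures and the Einstein–Lovelock tensors by $$h_{2k}=\frac{1}{(n-2k)!}\ast\bigl(g^{n-2k}R^k\bigr)\quad(2\le 2k\le n),\qquad T_{2k}=\frac{1}{(n-2k-1)!}\ast\bigl(g^{n-2k-1}R^k\bigr)\quad(2\le 2k<n),$$ and $T_n=0$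 if $n=2k$. Suppose that $(M,g)$ is conformally flat, that is, every point has an open neighbourhood $U$ and a smooth function $f$ on $U$ such that the metric $e^{2f}g$ on $U$ is flat (has zero curvature). Then: 1. If $2\le 2k\le n$, then at every point of $M$ one has $\sigma_k>0$ if and only if $h_{2k}>0$. In particular, the $\sigma_k$-curvature is positive on $M$ if and only if the Gauss–Bonnet curvature $h_{2k}$ is positive on $M$. 2. If $k\ge 1$ and $2k+2\le n$, then at every point of $M$ at which $h_2,h_4,\dots,h_{2k+2}$ are all positive, the tensors $T_2,T_4,\dots,T_{2k}$ are all positive definite. In particular, if $h_2,\dots,h_{2k+2}$ are positive on $M$, then $T_2,\dots,T_{2k}$ are positive definite on $M$. -/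

import Mathlib

open scoped Manifold ContDiff TensorProduct Bundle

noncomputable section

/-! ## Double forms on a Euclidean vector space

Throughout, `V` is an `n`-dimensional real inner product space with an orthonormal basis `e`. The
objects below do not depend on the choice of `e`. -/

namespace DoubleForm

variable {V : Type*} [NormedAddCommGroup V] [InnerProductSpace ℝ V]

/-- The exterior algebra `Λ V*`. -/
abbrev Forms (V : Type*) [NormedAddCommGroup V] [InnerProductSpace ℝ V] : Type _ :=
  ExteriorAlgebra ℝ (Module.Dual ℝ V)

/-- The algebra of double forms `Λ V* ⊗ Λ V*`, whose product is
`(a ⊗ b) (c ⊗ d) = (a ∧ c) ⊗ (b ∧ d)`. On `(1,1)`-forms it is the Kulkarni–Nomizu product. -/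
abbrev DForm (V : Type*) [NormedAddCommGroup V] [InnerProductSpace ℝ V] : Type _ :=
  Forms V ⊗[ℝ] Forms V

/-- The interior product `ι_v` on `Λ V*`. -/
def intProd (v : V) : Forms V →ₗ[ℝ] Forms V :=
  CliffordAlgebra.contractLeft (Module.Dual.eval ℝ V v)

variable {n : ℕ} (e : OrthonormalBasis (Fin n) ℝ V)

/-- The coframe `e^1, …, e^n` dual to `e`, inside `Λ V*`. -/
def coframe (i : Fin n) : Forms V := ExteriorAlgebra.ι ℝ (e.toBasis.coord i)

/-- The vector metrically dual to a linear form. -/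
def sharp : Module.Dual ℝ V →ₗ[ℝ] V :=
  ∑ i, LinearMap.smulRight (Module.Dual.eval ℝ V (e i)) (e i)

/-- The interior product by `φ♯`, seen in the opposite of the endomorphism algebra. -/
def interiorOp : Module.Dual ℝ V →ₗ[ℝ] (Module.End ℝ (Forms V))ᵐᵒᵖ :=
  (MulOpposite.opLinearEquiv ℝ).toLinearMap ∘ₗ CliffordAlgebra.contractLeft ∘ₗ
    Module.Dual.eval ℝ V ∘ₗ sharp e

theorem interiorOp_mul_self (φ : Module.Dual ℝ V) : interiorOp e φ * interiorOp e φ = 0 := by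
  refine MulOpposite.unop_injective (LinearMap.ext fun x => ?_)
  exact CliffordAlgebra.contractLeft_contractLeft (Module.Dual.eval ℝ V (sharp e φ)) x

/-- The volume form `e^1 ∧ ⋯ ∧ e^n`. -/
def vol : Forms V := ExteriorAlgebra.ιMulti ℝ n fun i => e.toBasis.coord i

/-- The Hodge star operator of `Λ V*` for the orientation given by `e`:
`⋆ (φ₁ ∧ ⋯ ∧ φ_p) = ι_{φ_p♯} ⋯ ι_{φ₁♯} vol`. -/
def hodge : Forms V →ₗ[ℝ] Forms V :=
  LinearMap.applyₗ (vol e) ∘ₗ (MulOpposite.opLinearEquiv ℝ).symm.toLinearMap ∘ₗ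
    (ExteriorAlgebra.lift ℝ ⟨interiorOp e, interiorOp_mul_self e⟩).toLinearMap

/-- The Hodge star operator on double forms, `⋆ (a ⊗ b) = ⋆ a ⊗ ⋆ b`. -/
def star : DForm V →ₗ[ℝ] DForm V := TensorProduct.map (hodge e) (hodge e)

/-- The `(1,1)`-double form of a bilinear form. -/
def ofBilin (a : V → V → ℝ) : DForm V :=
  ∑ i, ∑ j, a (e i) (e j) • (coframe e i ⊗ₜ[ℝ] coframe e j)

/-- The inner product as a `(1,1)`-double form. -/
def metric : DForm V := ofBilin e fun v w => inner ℝ v w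

/-- The `(2,2)`-double form of a curvature tensor `R(x,y;z,w)`, antisymmetric in `x,y` and in
`z,w`; the factor `1/4` is there because the sum is over all pairs of indices. -/
def ofCurvature (R : V → V → V → V → ℝ) : DForm V :=
  (1 / 4 : ℝ) • ∑ i, ∑ j, ∑ k, ∑ l, R (e i) (e j) (e k) (e l) •
    ((coframe e i * coframe e j) ⊗ₜ[ℝ] (coframe e k * coframe e l))

/-- The real number given by the `(0,0)`-component of a double form. -/
def toScalar (α : DForm V) : ℝ :=
  TensorProduct.lid ℝ ℝ (TensorProduct.map
    (ExteriorAlgebra.algebraMapInv (R := ℝ) (M := Module.Dual ℝ V)).toLinearMap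
    (ExteriorAlgebra.algebraMapInv (R := ℝ) (M := Module.Dual ℝ V)).toLinearMap α)

/-- The bilinear form given by the `(1,1)`-component of a double form. -/
def toBilin (α : DForm V) (v w : V) : ℝ :=
  toScalar (TensorProduct.map (intProd v) (intProd w) α)

/-- `h_{2k} = ⋆ (g^{n-2k} R^k) / (n-2k)!`, for `2k ≤ n`. -/
def gaussBonnet (R : V → V → V → V → ℝ) (k : ℕ) : ℝ :=
  (1 / ((n - 2 * k).factorial : ℝ)) *
    toScalar (star e (metric e ^ (n - 2 * k) * ofCurvature e R ^ k))

/-- `T_{2k} = ⋆ (g^{n-2k-1} R^k) / (n-2k-1)!`, for `2k < n`, and `T_n = 0`. -/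
def einsteinLovelock (R : V → V → V → V → ℝ) (k : ℕ) (v w : V) : ℝ :=
  if 2 * k = n then 0 else
    (1 / ((n - 2 * k - 1).factorial : ℝ)) *
      toBilin (star e (metric e ^ (n - 2 * k - 1) * ofCurvature e R ^ k)) v w

/-- The Ricci tensor of `R`. -/
def ricci (R : V → V → V → V → ℝ) (v w : V) : ℝ := ∑ i, R (e i) v (e i) w

/-- The scalar curvature of `R`. -/
def scal (R : V → V → V → V → ℝ) : ℝ := ∑ i, ricci e R (e i) (e i)

/-- The Schouten tensor `A = (Ric - Scal / (2(n-1)) g) / (n-2)`, for `n ≥ 3`. -/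
def schouten (R : V → V → V → V → ℝ) (v w : V) : ℝ :=
  (1 / ((n : ℝ) - 2)) * (ricci e R v w - scal e R / (2 * ((n : ℝ) - 1)) * inner ℝ v w)

/-- The matrix in the basis `e` of the endomorphism associated with a bilinear form through the
inner product. -/
def operatorMatrix (a : V → V → ℝ) : Matrix (Fin n) (Fin n) ℝ :=
  Matrix.of fun i j => a (e i) (e j)

/-- `σ_k`, the `k`-th elementary symmetric function of the eigenvalues, with multiplicity, of the
operator associated with the Schouten tensor. -/
def sigma (R : V → V → V → V → ℝ) (k : ℕ) : ℝ :=
  (operatorMatrix e (schouten e R)).charpoly.roots.esymm k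

end DoubleForm

/-! ## Curvature in coordinates -/

namespace Coord

variable {n : ℕ}

/-- The `i`-th partial derivative. -/
def partialDeriv (i : Fin n) (f : EuclideanSpace ℝ (Fin n) → ℝ)
    (y : EuclideanSpace ℝ (Fin n)) : ℝ :=
  fderiv ℝ f y (EuclideanSpace.single i 1)

/-- The Christoffel symbol `Γ^k_{ij}` of a metric `g` on an open subset of `ℝⁿ`. -/
def christoffel (g : EuclideanSpace ℝ (Fin n) → Matrix (Fin n) (Fin n) ℝ) (k i j : Fin n)
    (y : EuclideanSpace ℝ (Fin n)) : ℝ :=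
  (1 / 2 : ℝ) * ∑ l, (g y)⁻¹ k l *
    (partialDeriv i (fun z => g z j l) y + partialDeriv j (fun z => g z i l) y
      - partialDeriv l (fun z => g z i j) y)

/-- The `l`-th component of `R(∂_i, ∂_j) ∂_k = ∇_i ∇_j ∂_k - ∇_j ∇_i ∂_k`. -/
def curvatureUp (g : EuclideanSpace ℝ (Fin n) → Matrix (Fin n) (Fin n) ℝ) (l k i j : Fin n)
    (y : EuclideanSpace ℝ (Fin n)) : ℝ :=
  partialDeriv i (christoffel g l j k) y - partialDeriv j (christoffel g l i k) y
    + ∑ m, (christoffel g l i m y * christoffel g m j k y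
      - christoffel g l j m y * christoffel g m i k y)

/-- `R(∂_i, ∂_j; ∂_p, ∂_q) = g(R(∂_i, ∂_j) ∂_q, ∂_p)`. With this sign `R(u, v; u, v)` is the
sectional curvature of the plane of orthonormal vectors `u, v`. -/
def curvature (g : EuclideanSpace ℝ (Fin n) → Matrix (Fin n) (Fin n) ℝ) (i j p q : Fin n)
    (y : EuclideanSpace ℝ (Fin n)) : ℝ :=
  ∑ l, g y l p * curvatureUp g l q i j y

end Coord

/-! ## Riemannian manifolds -/

namespace RiemGeom

variable {n : ℕ} {M : Type*} [TopologicalSpace M] [ChartedSpace (EuclideanSpace ℝ (Fin n)) M]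

/-- The components, in the chart at `x`, of a field `G` of bilinear forms on the tangent spaces. -/
def chartMetric (G : ∀ p : M, TangentSpace (𝓡 n) p → TangentSpace (𝓡 n) p → ℝ) (x : M)
    (y : EuclideanSpace ℝ (Fin n)) : Matrix (Fin n) (Fin n) ℝ :=
  Matrix.of fun i j =>
    G ((extChartAt (𝓡 n) x).symm y)
      (mfderiv 𝓘(ℝ, EuclideanSpace ℝ (Fin n)) (𝓡 n) (extChartAt (𝓡 n) x).symm y
        (EuclideanSpace.single i (1 : ℝ) : EuclideanSpace ℝ (Fin n)))
      (mfderiv 𝓘(ℝ, EuclideanSpace ℝ (Fin n)) (𝓡 n) (extChartAt (𝓡 n) x).symm y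
        (EuclideanSpace.single j (1 : ℝ) : EuclideanSpace ℝ (Fin n)))

/-- The coordinates, in the chart at `x`, of a tangent vector at `x`. -/
def coordVec (x : M) (v : TangentSpace (𝓡 n) x) : EuclideanSpace ℝ (Fin n) :=
  mfderiv (𝓡 n) 𝓘(ℝ, EuclideanSpace ℝ (Fin n)) (extChartAt (𝓡 n) x) x v

/-- The Riemann curvature tensor `R(u, v; w, z)` at `x` of a Riemannian metric `G`, which need be
defined only near `x`. -/
def riemann (G : ∀ p : M, TangentSpace (𝓡 n) p → TangentSpace (𝓡 n) p → ℝ) (x : M)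
    (u v w z : TangentSpace (𝓡 n) x) : ℝ :=
  ∑ i, ∑ j, ∑ p, ∑ q, coordVec x u i * coordVec x v j * coordVec x w p * coordVec x z q *
    Coord.curvature (chartMetric G x) i j p q (extChartAt (𝓡 n) x x)

variable (n) in
theorem finrank_tangentSpace (x : M) : Module.finrank ℝ (TangentSpace (𝓡 n) x) = n :=
  finrank_euclideanSpace_fin (𝕜 := ℝ) (n := n)

instance (x : M) : FiniteDimensional ℝ (TangentSpace (𝓡 n) x) :=
  inferInstanceAs (FiniteDimensional ℝ (EuclideanSpace ℝ (Fin n)))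

variable (n M) [Bundle.RiemannianBundle (fun x : M => TangentSpace (𝓡 n) x)]

/-- The Riemannian metric of `M`. -/
def metric (p : M) (v w : TangentSpace (𝓡 n) p) : ℝ := inner ℝ v w

/-- `M` is (locally) conformally flat: every point has a neighbourhood `U` with a smooth function
`f` such that the metric `e^{2f} g` on `U` is flat, that is, has zero curvature. -/
def IsConformallyFlat : Prop :=
  ∀ x : M, ∃ U : Set M, IsOpen U ∧ x ∈ U ∧ ∃ f : M → ℝ, ContMDiffOn (𝓡 n) 𝓘(ℝ) ∞ f U ∧
    ∀ p ∈ U, ∀ u v w z : TangentSpace (𝓡 n) p,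
      riemann (fun q a b => Real.exp (2 * f q) * metric n M q a b) p u v w z = 0

variable {M}

/-- An orthonormal basis of the tangent space at `x`. -/
def frame (x : M) : OrthonormalBasis (Fin n) ℝ (TangentSpace (𝓡 n) x) :=
  (stdOrthonormalBasis ℝ (TangentSpace (𝓡 n) x)).reindex (finCongr (finrank_tangentSpace n x))

/-- The `σ_k`-curvature of `M`. -/
def sigma (k : ℕ) (x : M) : ℝ := DoubleForm.sigma (frame n x) (riemann (metric n M) x) k

/-- The `2k`-th Gauss–Bonnet curvature `h_{2k}` of `M`. -/
def gaussBonnet (k : ℕ) (x : M) : ℝ :=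
  DoubleForm.gaussBonnet (frame n x) (riemann (metric n M) x) k

/-- The `2k`-th Einstein–Lovelock tensor `T_{2k}` of `M`. -/
def einsteinLovelock (k : ℕ) (x : M) (v w : TangentSpace (𝓡 n) x) : ℝ :=
  DoubleForm.einsteinLovelock (frame n x) (riemann (metric n M) x) k v w

end RiemGeom

end

open scoped Manifold ContDiff TensorProduct Bundle

noncomputable section

/-! The conformal change formula shows that, where `e^{2f} g` is flat, the curvature is a product `R
= g B` in the algebra of double forms, with `B` symmetric (`Coord.exists_curvature_eq`,
`RiemGeom.exists_isKulkarniNomizu`). Contracting identifies `B` with the Schouten tensor when `n ≥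
3`. The rest is algebra at one point.

Since `R^k = g^k B^k`, the curvature `h_{2k}` is a positive multiple of `⋆(g^{n-k} B^k)`. The `n`-th
power of a `(1,1)`-form is `n!` times its determinant (`ofMatrix_pow`), so `⋆(g + tB)^n = n! ∏ (1 +
t λ_i)`. Comparing coefficients of `t^k` makes `h_{2k}` a positive multiple of `σ_k`, which is the
first claim.

For the second, `T_{2k}(v,v)` is a positive multiple of `⋆(g^{n-1-k} B^k (v♭ ⊗ v♭))`. The factor `v♭
⊗ v♭` squares to zero, so the generating function in `t` is a difference of determinants under a
rank-one perturbation. In an eigenbasis this gives a positive multiple of `∑ w_i² σ_k(λ without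
λ_i)` with `w ≠ 0`. If `σ_1, …, σ_{k+1}` are positive at `λ`, then `σ_r(λ without λ_i) > 0` for all
`r ≤ k`: this follows from Newton's inequalities (`genPoly_coeff_pos_of_cons`). -/

/-! ### Powers of sums of square-zero elements; alternating maps and determinants. -/

theorem add_pow_succ_of_mul_self_eq_zero {A : Type*} [Ring A] {x y : A} (hc : Commute x y)
    (hx : x * x = 0) (p : ℕ) : (x + y) ^ (p + 1) = y ^ (p + 1) + (p + 1) • (x * y ^ p) := by
  induction p with
  | zero => simp [add_comm]
  | succ p ih =>
    have e1 : x * y ^ (p + 1) = x * y ^ p * y := by rw [pow_succ, mul_assoc]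
    have e2 : y ^ (p + 1) * x = x * y ^ (p + 1) := (hc.pow_right _).symm.eq
    have e3 : x * y ^ p * x = 0 := by
      rw [mul_assoc, (hc.pow_right _).symm.eq, ← mul_assoc, hx, zero_mul]
    rw [pow_succ, ih, add_mul, mul_add, mul_add, e2, smul_mul_assoc, smul_mul_assoc, e3,
      ← e1, ← pow_succ, smul_zero, zero_add, succ_nsmul (x * y ^ (p + 1)) (p + 1)]
    abel

/-- Only the squarefree monomial survives the multinomial expansion. The vanishing of the next power
is carried along because the induction step needs it to discard the terms without `x 0`. -/
theorem sum_pow_eq_factorial_smul_prod {A : Type*} [Ring A] (m : ℕ) (x : Fin m → A)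
    (hc : ∀ i j, Commute (x i) (x j)) (hs : ∀ i, x i * x i = 0) :
    (∑ i, x i) ^ m = m.factorial • (List.ofFn x).prod ∧ (∑ i, x i) ^ (m + 1) = 0 := by
  induction m with
  | zero => simp
  | succ m ih =>
    obtain ⟨h1, h2⟩ := ih (fun i => x i.succ) (fun i j => hc _ _) (fun i => hs _)
    set S := ∑ i : Fin m, x i.succ with hS
    have hcS : Commute (x 0) S := Commute.sum_right _ _ _ fun i _ => hc _ _
    have key := fun p => add_pow_succ_of_mul_self_eq_zero hcS (hs 0) p
    rw [Fin.sum_univ_succ, ← hS, key, key, h2, List.ofFn_succ, List.prod_cons, h1]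
    refine ⟨?_, ?_⟩
    · rw [zero_add, mul_smul_comm, smul_smul, Nat.factorial_succ]
    · rw [pow_succ, h2]; simp

/-- Both sides are alternating in the rows of `C`, so it is enough to compare them on permutations
of the standard basis. -/
theorem map_sum_smul_eq_det_smul {n : ℕ} {E F : Type*} [AddCommGroup E] [Module ℝ E]
    [AddCommGroup F] [Module ℝ F] (f : E [⋀^Fin n]→ₗ[ℝ] F) (C : Matrix (Fin n) (Fin n) ℝ)
    (b : Fin n → E) : f (fun i => ∑ j, C i j • b j) = C.det • f b := by
  have h : f.compLinearMap (Fintype.linearCombination ℝ b) =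
      (LinearMap.toSpanSingleton ℝ F (f b)).compAlternatingMap Matrix.detRowAlternating := by
    refine Module.Basis.ext_alternating (Pi.basisFun ℝ (Fin n)) fun v hv => ?_
    obtain ⟨σ, rfl⟩ : ∃ σ : Equiv.Perm (Fin n), ⇑σ = v :=
      ⟨Equiv.ofBijective v (Finite.injective_iff_bijective.mp hv), rfl⟩
    have h1 : ∀ g : (Fin n → ℝ) [⋀^Fin n]→ₗ[ℝ] F, g (fun i => Pi.basisFun ℝ (Fin n) (σ i)) =
        Equiv.Perm.sign σ • g (Pi.basisFun ℝ (Fin n)) := fun g => g.map_perm _ σ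
    rw [h1, h1]
    congr 1
    have h2 : (Matrix.detRowAlternating (R := ℝ) fun i => Pi.basisFun ℝ (Fin n) i) = 1 := by
      have h4 : (Matrix.of fun i j => Pi.basisFun ℝ (Fin n) i j) = 1 := by
        ext i j
        simp [Matrix.one_apply, Pi.single_apply, eq_comm]
      change Matrix.det (Matrix.of fun i j => Pi.basisFun ℝ (Fin n) i j) = 1
      rw [h4, Matrix.det_one]
    have h3 : ∀ i, Fintype.linearCombination ℝ b (Pi.basisFun ℝ (Fin n) i) = b i := by
      intro i; simp
    simp only [AlternatingMap.compLinearMap_apply, LinearMap.compAlternatingMap_apply, h3]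
    rw [h2]; simp
  have h' : f (fun i => Fintype.linearCombination ℝ b fun j => C i j) = C.det • f b :=
    DFunLike.congr_fun h fun i j => C i j
  simpa only [Fintype.linearCombination_apply] using h'

/-! ### The Hodge star on top powers of `(1,1)`-double forms. -/

namespace DoubleForm

variable {V : Type*} [NormedAddCommGroup V] [InnerProductSpace ℝ V]
variable {n : ℕ} (e : OrthonormalBasis (Fin n) ℝ V)

/-- The double form `∑ C i j e^i ⊗ e^j`. -/
def ofMatrix (C : Matrix (Fin n) (Fin n) ℝ) : DForm V :=
  ∑ i, ∑ j, C i j • (coframe e i ⊗ₜ[ℝ] coframe e j)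

theorem ofBilin_eq_ofMatrix (a : V → V → ℝ) : ofBilin e a = ofMatrix e (operatorMatrix e a) := rfl

theorem operatorMatrix_inner :
    operatorMatrix e (fun v w => inner ℝ v w) = (1 : Matrix (Fin n) (Fin n) ℝ) := by
  ext i j
  simp [operatorMatrix, Matrix.one_apply, orthonormal_iff_ite.mp e.orthonormal]

theorem metric_eq_ofMatrix : metric e = ofMatrix e 1 := by
  rw [metric, ofBilin_eq_ofMatrix, operatorMatrix_inner]

theorem ofMatrix_add (C D : Matrix (Fin n) (Fin n) ℝ) :
    ofMatrix e (C + D) = ofMatrix e C + ofMatrix e D := by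
  simp [ofMatrix, add_smul, Finset.sum_add_distrib]

theorem ofMatrix_smul (t : ℝ) (C : Matrix (Fin n) (Fin n) ℝ) :
    ofMatrix e (t • C) = t • ofMatrix e C := by
  simp [ofMatrix, mul_smul, Finset.smul_sum]

theorem ι_mul_ι_comm (φ ψ : Module.Dual ℝ V) :
    (ExteriorAlgebra.ι ℝ φ * ExteriorAlgebra.ι ℝ ψ : Forms V) =
      -(ExteriorAlgebra.ι ℝ ψ * ExteriorAlgebra.ι ℝ φ) :=
  eq_neg_of_add_eq_zero_left (ExteriorAlgebra.ι_add_mul_swap φ ψ)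

theorem commute_ι_tmul_ι (φ ψ φ' ψ' : Module.Dual ℝ V) :
    Commute ((ExteriorAlgebra.ι ℝ φ ⊗ₜ[ℝ] ExteriorAlgebra.ι ℝ ψ : DForm V))
      (ExteriorAlgebra.ι ℝ φ' ⊗ₜ[ℝ] ExteriorAlgebra.ι ℝ ψ') := by
  rw [Commute, SemiconjBy, Algebra.TensorProduct.tmul_mul_tmul,
    Algebra.TensorProduct.tmul_mul_tmul, ι_mul_ι_comm φ, ι_mul_ι_comm ψ, TensorProduct.neg_tmul,
    TensorProduct.tmul_neg, neg_neg]

theorem commute_ofMatrix (C D : Matrix (Fin n) (Fin n) ℝ) :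
    Commute (ofMatrix e C) (ofMatrix e D) := by
  refine Commute.sum_left _ _ _ fun i _ => Commute.sum_left _ _ _ fun j _ =>
    Commute.sum_right _ _ _ fun k _ => Commute.sum_right _ _ _ fun l _ => ?_
  exact ((commute_ι_tmul_ι _ _ _ _).smul_left _).smul_right _

theorem ofMatrix_vecMulVec (x y : Fin n → ℝ) :
    ofMatrix e (Matrix.vecMulVec x y) =
      ExteriorAlgebra.ι ℝ (∑ i, x i • e.toBasis.coord i) ⊗ₜ[ℝ]
        ExteriorAlgebra.ι ℝ (∑ i, y i • e.toBasis.coord i) := by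
  simp_rw [map_sum, TensorProduct.sum_tmul, TensorProduct.tmul_sum, map_smul,
    TensorProduct.tmul_smul, ← TensorProduct.smul_tmul', smul_smul, ofMatrix,
    Matrix.vecMulVec_apply, mul_comm (x _)]
  rfl

theorem prod_ofFn_tmul {A B : Type*} [Ring A] [Algebra ℝ A] [Ring B] [Algebra ℝ B] (m : ℕ)
    (a : Fin m → A) (b : Fin m → B) :
    (List.ofFn fun i => a i ⊗ₜ[ℝ] b i).prod = (List.ofFn a).prod ⊗ₜ[ℝ] (List.ofFn b).prod := by
  induction m with
  | zero => simp [Algebra.TensorProduct.one_def]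
  | succ m ih => simp [List.ofFn_succ, ih, Algebra.TensorProduct.tmul_mul_tmul]

/-- The top power of a `(1,1)`-double form is its determinant times the volume double form. -/
theorem ofMatrix_pow (C : Matrix (Fin n) (Fin n) ℝ) :
    ofMatrix e C ^ n = (n.factorial * C.det : ℝ) • (vol e ⊗ₜ[ℝ] vol e) := by
  -- Grouping by rows leaves `n` commuting square-zero summands; the second factor of their product
  -- is the wedge of the rows of `C`.
  have h : ofMatrix e C = ∑ i, coframe e i ⊗ₜ[ℝ]
      ExteriorAlgebra.ι ℝ (∑ j, C i j • e.toBasis.coord j) := by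
    simp [ofMatrix, map_sum, TensorProduct.tmul_sum, TensorProduct.tmul_smul, coframe]
  have hdet := map_sum_smul_eq_det_smul (ExteriorAlgebra.ιMulti ℝ n) C fun j => e.toBasis.coord j
  rw [h, (sum_pow_eq_factorial_smul_prod n (fun i => coframe e i ⊗ₜ[ℝ]
      ExteriorAlgebra.ι ℝ (∑ j, C i j • e.toBasis.coord j))
    (fun i j => commute_ι_tmul_ι _ _ _ _) ?_).1, prod_ofFn_tmul]
  · have hv : (List.ofFn (coframe e)).prod = vol e := by
      rw [vol, ExteriorAlgebra.ιMulti_apply]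
      rfl
    rw [← ExteriorAlgebra.ιMulti_apply, hdet, hv, TensorProduct.tmul_smul, mul_smul,
      Nat.cast_smul_eq_nsmul]
    rfl
  · intro i
    rw [Algebra.TensorProduct.tmul_mul_tmul, ExteriorAlgebra.ι_sq_zero, TensorProduct.tmul_zero]

/-- The linear functional `α ↦ ⋆ α` with values in the `(0,0)`-component. -/
def starScalar : DForm V →ₗ[ℝ] ℝ :=
  (TensorProduct.lid ℝ ℝ).toLinearMap ∘ₗ TensorProduct.map
    (ExteriorAlgebra.algebraMapInv (R := ℝ) (M := Module.Dual ℝ V)).toLinearMap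
    (ExteriorAlgebra.algebraMapInv (R := ℝ) (M := Module.Dual ℝ V)).toLinearMap ∘ₗ star e

theorem starScalar_apply (α : DForm V) : starScalar e α = toScalar (star e α) := rfl

theorem intProd_coframe_mul (i j : Fin n) (x : Forms V) :
    intProd (e i) (coframe e j * x) =
      (if i = j then 1 else 0 : ℝ) • x - coframe e j * intProd (e i) x := by
  rw [intProd, coframe]
  erw [CliffordAlgebra.contractLeft_ι_mul]
  simp [eq_comm]

theorem intProd_prod_of_notMem (i : Fin n) (l : List (Fin n)) (h : i ∉ l) :
    intProd (e i) (l.map (coframe e)).prod = 0 := by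
  induction l with
  | nil => exact CliffordAlgebra.contractLeft_one (Q := (0 : QuadraticForm ℝ (Module.Dual ℝ V))) _
  | cons j l ih =>
    rw [List.mem_cons, not_or] at h
    rw [List.map_cons, List.prod_cons, intProd_coframe_mul, ih h.2, if_neg h.1]
    simp

theorem sharp_coord (i : Fin n) : sharp e (e.toBasis.coord i) = e i := by
  simp [sharp]

/-- The product of the interior products that defines the Hodge star. -/
def interiorLift : Forms V →ₐ[ℝ] (Module.End ℝ (Forms V))ᵐᵒᵖ :=
  ExteriorAlgebra.lift ℝ ⟨interiorOp e, interiorOp_mul_self e⟩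

theorem hodge_apply (x : Forms V) : hodge e x = (interiorLift e x).unop (vol e) := rfl

theorem interiorLift_ι (φ : Module.Dual ℝ V) :
    (interiorLift e (ExteriorAlgebra.ι ℝ φ)).unop = intProd (sharp e φ) := by
  rw [interiorLift, ExteriorAlgebra.lift_ι_apply]
  rfl

/-- The lift takes values in the opposite algebra, so a factor multiplied on the right is contracted
last. -/
theorem hodge_mul_ι (x : Forms V) (φ : Module.Dual ℝ V) :
    hodge e (x * ExteriorAlgebra.ι ℝ φ) = intProd (sharp e φ) (hodge e x) := by
  rw [hodge_apply, map_mul, MulOpposite.unop_mul, interiorLift_ι]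
  rfl

/-- The first contraction strips the leading covector; it annihilates the remaining product, where
that index does not recur. -/
theorem interiorLift_prod (l : List (Fin n)) (h : l.Nodup) :
    (interiorLift e (l.map (coframe e)).prod).unop (l.map (coframe e)).prod = 1 := by
  induction l with
  | nil => simp
  | cons i l ih =>
    rw [List.nodup_cons] at h
    rw [List.map_cons, List.prod_cons, map_mul (interiorLift e), MulOpposite.unop_mul,
      Module.End.mul_apply]
    have h1 : (interiorLift e (coframe e i)).unop = intProd (sharp e (e.toBasis.coord i)) :=
      interiorLift_ι e _
    rw [h1, sharp_coord, intProd_coframe_mul, intProd_prod_of_notMem e i l h.1]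
    simpa using ih h.2

theorem hodge_vol : hodge e (vol e) = 1 := by
  have h : vol e = ((List.finRange n).map (coframe e)).prod := by
    rw [vol, ExteriorAlgebra.ιMulti_apply, List.ofFn_eq_map]
    rfl
  rw [hodge_apply, h]
  exact interiorLift_prod e _ (List.nodup_finRange n)

theorem starScalar_vol : starScalar e (vol e ⊗ₜ[ℝ] vol e) = 1 := by
  simp [starScalar, star, hodge_vol]

theorem starScalar_ofMatrix_pow (C : Matrix (Fin n) (Fin n) ℝ) :
    starScalar e (ofMatrix e C ^ n) = n.factorial * C.det := by
  rw [ofMatrix_pow, map_smul, starScalar_vol, smul_eq_mul, mul_one]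

/-- This turns values of the Einstein–Lovelock tensors into top-degree products, to which the
determinant formula applies. It is `hodge_mul_ι` in both factors. -/
theorem toBilin_star (α : DForm V) (φ ψ : Module.Dual ℝ V) :
    toBilin (star e α) (sharp e φ) (sharp e ψ) =
      starScalar e (α * (ExteriorAlgebra.ι ℝ φ ⊗ₜ[ℝ] ExteriorAlgebra.ι ℝ ψ)) := by
  rw [toBilin, starScalar_apply]
  congr 1
  induction α using TensorProduct.induction_on with
  | zero => simp
  | add x y hx hy => simp only [map_add, add_mul, hx, hy]
  | tmul a b =>
    simp [star, Algebra.TensorProduct.tmul_mul_tmul, hodge_mul_ι]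

theorem sharp_sum_coord (v : V) : sharp e (∑ i, inner ℝ (e i) v • e.toBasis.coord i) = v := by
  simp_rw [map_sum, map_smul, sharp_coord]
  exact e.sum_repr' v

theorem toBilin_star_self (α : DForm V) (v : V) :
    toBilin (star e α) v v = starScalar e (α * ofMatrix e
      (Matrix.vecMulVec (fun i => inner ℝ (e i) v) fun i => inner ℝ (e i) v)) := by
  rw [ofMatrix_vecMulVec, ← toBilin_star, sharp_sum_coord]

/-- The form of a rank-one matrix squares to zero, so the `n`-th power of the perturbed form has
only two terms; the formula for top powers evaluates it and the unperturbed power. -/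
theorem starScalar_pow_mul_vecMulVec (C : Matrix (Fin n) (Fin n) ℝ) (x : Fin n → ℝ)
    (hn : 0 < n) :
    n * starScalar e (ofMatrix e C ^ (n - 1) * ofMatrix e (Matrix.vecMulVec x x)) =
      n.factorial * ((C + Matrix.vecMulVec x x).det - C.det) := by
  have hsq : ofMatrix e (Matrix.vecMulVec x x) * ofMatrix e (Matrix.vecMulVec x x) = 0 := by
    rw [ofMatrix_vecMulVec, Algebra.TensorProduct.tmul_mul_tmul, ExteriorAlgebra.ι_sq_zero,
      TensorProduct.zero_tmul]
  have key : ∀ m, (ofMatrix e C + ofMatrix e (Matrix.vecMulVec x x)) ^ (m + 1) =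
      ofMatrix e C ^ (m + 1) +
        (m + 1 : ℕ) • (ofMatrix e C ^ m * ofMatrix e (Matrix.vecMulVec x x)) := by
    intro m
    rw [add_comm, add_pow_succ_of_mul_self_eq_zero (commute_ofMatrix e _ _) hsq,
      ((commute_ofMatrix e _ _).pow_right _).eq]
  obtain ⟨m, rfl⟩ : ∃ m, n = m + 1 := ⟨n - 1, by omega⟩
  have h1 := starScalar_ofMatrix_pow e (C + Matrix.vecMulVec x x)
  rw [ofMatrix_add, key, map_add, starScalar_ofMatrix_pow, map_nsmul, nsmul_eq_mul] at h1
  rw [mul_sub, ← h1, Nat.add_sub_cancel]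
  ring

end DoubleForm

/-! ### Newton's inequalities and elementary symmetric functions. -/

section RealRooted

open Polynomial

/-- By Rolle's theorem with multiplicities, passing to the derivative loses at most one root, and
the degree drops by one. -/
theorem Polynomial.Splits.derivative_real {p : ℝ[X]} (h : p.Splits) : p.derivative.Splits := by
  rw [splits_iff_card_roots] at h ⊢
  have h1 := card_roots_le_derivative p
  have h2 := p.derivative.card_roots'
  have h3 := natDegree_derivative_le p
  rcases Nat.eq_zero_or_pos p.natDegree with h0 | h0
  · rw [natDegree_eq_zero] at h0
    obtain ⟨c, rfl⟩ := h0
    simp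
  · omega

/-- Laguerre's inequality at the origin. -/
theorem Polynomial.Splits.laguerre {p : ℝ[X]} (h : p.Splits) :
    2 * (p.coeff 0 * p.coeff 2) ≤ p.coeff 1 ^ 2 := by
  have key : ∀ m : Multiset ℝ, ∀ q : ℝ[X], q = (m.map fun a => X - C a).prod →
      2 * (q.coeff 0 * q.coeff 2) ≤ q.coeff 1 ^ 2 := by
    intro m
    induction m using Multiset.induction_on with
    | empty => rintro q rfl; simp [coeff_one]
    | cons a m ih =>
      rintro q rfl
      have := ih _ rfl
      rw [Multiset.map_cons, Multiset.prod_cons, sub_mul]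
      generalize (m.map fun a => X - C a).prod = r at *
      simp only [coeff_sub, coeff_X_mul, coeff_C_mul, mul_coeff_zero, coeff_X_zero, zero_mul,
        coeff_C_zero]
      -- For `q = (X - a) r` one has `q₁² - 2 q₀ q₂ = r₀² + a² (r₁² - 2 r₀ r₂)`.
      nlinarith [sq_nonneg (r.coeff 0), mul_nonneg (sq_nonneg a) (sub_nonneg.mpr this)]
  have h1 := key p.roots _ rfl
  rw [h.eq_prod_roots]
  simp only [coeff_C_mul]
  nlinarith [mul_nonneg (sq_nonneg p.leadingCoeff) (sub_nonneg.mpr h1)]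

/-- Differentiation preserves real-rootedness and lowers the index by one, so Laguerre's inequality
at the origin propagates to every coefficient. -/
theorem Polynomial.Splits.coeff_newton {p : ℝ[X]} (h : p.Splits) (j : ℕ) :
    (j + 2 : ℝ) * (p.coeff j * p.coeff (j + 2)) ≤ (j + 1) * p.coeff (j + 1) ^ 2 := by
  induction j generalizing p with
  | zero => simpa using h.laguerre
  | succ j ih =>
    have h1 := ih h.derivative_real
    simp only [coeff_derivative] at h1
    push_cast at h1 ⊢
    have h2 : (0 : ℝ) < (j + 1) * (j + 2) := by positivity
    refine le_of_mul_le_mul_left ?_ h2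
    ring_nf at h1 ⊢
    linarith

theorem Polynomial.Splits.coeff_mul_coeff_le_sq {p : ℝ[X]} (h : p.Splits) (j : ℕ) :
    p.coeff j * p.coeff (j + 2) ≤ p.coeff (j + 1) ^ 2 := by
  have h1 := h.coeff_newton j
  by_contra! h2
  have h3 := mul_lt_mul_of_pos_left h2 (by positivity : (0 : ℝ) < j + 1)
  nlinarith [sq_nonneg (p.coeff (j + 1))]

/-- The polynomial `∏ (1 + a X)`, whose coefficients are the elementary symmetric functions. -/
def genPoly (m : Multiset ℝ) : ℝ[X] := (m.map fun a => 1 + C a * X).prod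

theorem genPoly_cons (a : ℝ) (m : Multiset ℝ) :
    genPoly (a ::ₘ m) = (1 + C a * X) * genPoly m := by
  simp [genPoly]

theorem genPoly_coeff_zero (m : Multiset ℝ) : (genPoly m).coeff 0 = 1 := by
  induction m using Multiset.induction_on with
  | empty => simp [genPoly]
  | cons a m ih => simp [genPoly_cons, mul_coeff_zero, ih]

theorem genPoly_cons_coeff_succ (a : ℝ) (m : Multiset ℝ) (k : ℕ) :
    (genPoly (a ::ₘ m)).coeff (k + 1) = (genPoly m).coeff (k + 1) + a * (genPoly m).coeff k := by
  rw [genPoly_cons, add_mul, one_mul, mul_assoc, coeff_add, coeff_C_mul, coeff_X_mul]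

theorem genPoly_coeff (m : Multiset ℝ) (k : ℕ) : (genPoly m).coeff k = m.esymm k := by
  induction m using Multiset.induction_on generalizing k with
  | empty =>
    rcases k with _ | k
    · simp [genPoly, Multiset.esymm]
    · simp [genPoly, Multiset.esymm, coeff_one, Multiset.powersetCard_zero_right]
  | cons a m ih =>
    rcases k with _ | k
    · simp [genPoly_coeff_zero, Multiset.esymm]
    · rw [genPoly_cons_coeff_succ, ih, ih]
      simp [Multiset.esymm, Multiset.powersetCard_cons, Multiset.sum_map_mul_left]

theorem genPoly_splits (m : Multiset ℝ) : (genPoly m).Splits := by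
  induction m using Multiset.induction_on with
  | empty => simp [genPoly]
  | cons a m ih =>
    rw [genPoly_cons]
    refine Splits.mul (Splits.of_natDegree_le_one ?_) ih
    compute_degree

/-- If the first elementary symmetric functions of `a, m` are positive, so are those of `m`, up to
one degree less. -/
theorem genPoly_coeff_pos_of_cons (a : ℝ) (m : Multiset ℝ) (K : ℕ)
    (h : ∀ r ≤ K + 1, 0 < (genPoly (a ::ₘ m)).coeff r) (r : ℕ) (hr : r ≤ K) :
    0 < (genPoly m).coeff r := by
  induction r with
  | zero => simp [genPoly_coeff_zero]
  | succ r ih =>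
    have h0 := ih (by omega)
    have h1 := h (r + 1) (by omega)
    have h2 := h (r + 2) (by omega)
    rw [genPoly_cons_coeff_succ] at h1 h2
    have h3 := (genPoly_splits m).coeff_mul_coeff_le_sq r
    -- Let `x, y, z` be the coefficients of `m` at `r, r+1, r+2`, with `x > 0` and `y ≤ 0`. Then `y
    -- + a x > 0`, `z + a y > 0` and `x z ≤ y²` give `0 < x (z + a y) ≤ y (y + a x) ≤ 0`.
    by_contra! hneg
    generalize (genPoly m).coeff r = x at *
    generalize (genPoly m).coeff (r + 1) = y at *
    generalize (genPoly m).coeff (r + 2) = z at *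
    nlinarith [mul_nonneg (neg_nonneg.mpr hneg) h1.le, mul_pos h0 h2]

end RealRooted

/-! ### Determinants of `1 + tB` and of its rank-one perturbations. -/

section Determinants

open Polynomial Matrix

variable {n : ℕ}

theorem prod_one_add_mul_eq_eval_genPoly (s : Finset (Fin n)) (l : Fin n → ℝ) (t : ℝ) :
    ∏ i ∈ s, (1 + t * l i) = (genPoly (s.val.map l)).eval t := by
  rw [genPoly, eval_multiset_prod, Multiset.map_map, Multiset.map_map, Finset.prod]
  congr 2
  funext i
  simp only [Function.comp_apply, eval_add, eval_one, eval_mul, eval_C, eval_X, mul_comm]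

/-- The matrix determinant lemma, with the inverse entries absorbed into the products. -/
theorem det_diagonal_add_vecMulVec (d w : Fin n → ℝ) (hd : ∀ i, d i ≠ 0) :
    (diagonal d + vecMulVec w w).det =
      (diagonal d).det + ∑ i, w i ^ 2 * ∏ j ∈ Finset.univ.erase i, d j := by
  have hu : IsUnit (diagonal d).det := by
    rw [det_diagonal, isUnit_iff_ne_zero]
    exact Finset.prod_ne_zero_iff.mpr fun i _ => hd i
  have h := det_add_replicateCol_mul_replicateRow (ι := Unit) hu w w
  rw [← vecMulVec_eq] at h
  have hinv : (diagonal d)⁻¹ = diagonal fun i => (d i)⁻¹ := by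
    refine inv_eq_right_inv ?_
    rw [diagonal_mul_diagonal]
    simp [hd]
  rw [h, hinv, det_unique (n := Unit), det_diagonal, Matrix.add_apply, mul_apply]
  simp only [mul_diagonal, one_apply_eq, replicateRow_apply, replicateCol_apply, mul_add, mul_one,
    Finset.mul_sum]
  congr 1
  refine Finset.sum_congr rfl fun i _ => ?_
  rw [← Finset.mul_prod_erase _ _ (Finset.mem_univ i)]
  have := hd i
  field_simp

theorem Matrix.IsHermitian.exists_eigenvalues_orthogonal {B : Matrix (Fin n) (Fin n) ℝ}
    (hB : B.IsHermitian) : ∃ U : Matrix (Fin n) (Fin n) ℝ, Uᵀ * U = 1 ∧ U * Uᵀ = 1 ∧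
      B = U * diagonal hB.eigenvalues * Uᵀ := by
  refine ⟨hB.eigenvectorUnitary, ?_, ?_, ?_⟩
  · simpa [star_eq_conjTranspose] using Unitary.coe_star_mul_self hB.eigenvectorUnitary
  · simpa [star_eq_conjTranspose] using Unitary.coe_mul_star_self hB.eigenvectorUnitary
  · have h := hB.spectral_theorem
    rw [Unitary.conjStarAlgAut_apply] at h
    simpa [star_eq_conjTranspose] using h

theorem Matrix.IsHermitian.det_one_add_smul {B : Matrix (Fin n) (Fin n) ℝ} (hB : B.IsHermitian)
    (t : ℝ) : (1 + t • B).det = (genPoly (Finset.univ.val.map hB.eigenvalues)).eval t := by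
  obtain ⟨U, h1, h2, h3⟩ := hB.exists_eigenvalues_orthogonal
  have h4 : 1 + t • B = U * diagonal (fun i => 1 + t * hB.eigenvalues i) * Uᵀ := by
    have : diagonal (fun i => 1 + t * hB.eigenvalues i) = 1 + t • diagonal hB.eigenvalues := by
      ext i j
      rcases eq_or_ne i j with rfl | h <;> simp [*]
    rw [this, mul_add, add_mul, mul_one, h2, mul_smul_comm, smul_mul_assoc, ← h3]
  rw [h4, det_mul_right_comm, h2, one_mul, det_diagonal, prod_one_add_mul_eq_eval_genPoly]

/-- The vector `w` holds the coordinates of `x` in an orthonormal eigenbasis of `B`. It is chosen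
before `t`, so coefficients in `t` can be compared later. -/
theorem Matrix.IsHermitian.exists_det_one_add_smul_add_vecMulVec {B : Matrix (Fin n) (Fin n) ℝ}
    (hB : B.IsHermitian) (x : Fin n → ℝ) : ∃ w : Fin n → ℝ, (x ≠ 0 → w ≠ 0) ∧
      ∀ t : ℝ, (∀ i, 1 + t * hB.eigenvalues i ≠ 0) →
        (1 + t • B + vecMulVec x x).det = (1 + t • B).det +
          ∑ i, w i ^ 2 * (genPoly ((Finset.univ.erase i).val.map hB.eigenvalues)).eval t := by
  obtain ⟨U, h1, h2, h3⟩ := hB.exists_eigenvalues_orthogonal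
  refine ⟨Uᵀ *ᵥ x, fun hx hw => hx ?_, fun t ht => ?_⟩
  · rw [← one_mulVec x, ← h2, ← mulVec_mulVec, hw, mulVec_zero]
  · have hd : diagonal (fun i => 1 + t * hB.eigenvalues i) = 1 + t • diagonal hB.eigenvalues := by
      ext i j
      rcases eq_or_ne i j with rfl | h <;> simp [*]
    have h4 : 1 + t • B = U * diagonal (fun i => 1 + t * hB.eigenvalues i) * Uᵀ := by
      rw [hd, mul_add, add_mul, mul_one, h2, mul_smul_comm, smul_mul_assoc, ← h3]
    have h5 : vecMulVec x x = U * vecMulVec (Uᵀ *ᵥ x) (Uᵀ *ᵥ x) * Uᵀ := by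
      rw [mul_vecMulVec, vecMulVec_mul, mulVec_mulVec, h2, one_mulVec, vecMul_transpose,
        mulVec_mulVec, h2, one_mulVec]
    rw [h5, h4, ← add_mul, ← mul_add, det_mul_right_comm, h2, one_mul, det_mul_right_comm, h2,
      one_mul, det_diagonal_add_vecMulVec _ _ ht]
    simp only [prod_one_add_mul_eq_eval_genPoly]

end Determinants

/-! ### Gauss–Bonnet curvatures and Einstein–Lovelock tensors when `R = g B`. -/

namespace DoubleForm

variable {V : Type*} [NormedAddCommGroup V] [InnerProductSpace ℝ V]
variable {n : ℕ} (e : OrthonormalBasis (Fin n) ℝ V)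

/-- The curvature tensor `R` is the Kulkarni–Nomizu product of the inner product with `B`. -/
def IsKulkarniNomizu (R : V → V → V → V → ℝ) (B : V → V → ℝ) : Prop :=
  ∀ u v w z, R u v w z = inner ℝ u w * B v z + inner ℝ v z * B u w - inner ℝ u z * B v w -
    inner ℝ v w * B u z

variable {R : V → V → V → V → ℝ} {B : V → V → ℝ}

theorem inner_basis (i j : Fin n) : inner ℝ (e i) (e j) = (if i = j then 1 else 0 : ℝ) :=
  orthonormal_iff_ite.mp e.orthonormal i j

/-- By antisymmetry in each pair of indices, the four terms of the Kulkarni–Nomizu product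
contribute equally, which cancels the factor `1/4`. -/
theorem IsKulkarniNomizu.ofCurvature_eq (h : IsKulkarniNomizu R B) :
    ofCurvature e R = metric e * ofBilin e B := by
  set F : Fin n → Fin n → Fin n → Fin n → DForm V := fun i j k l =>
    (coframe e i * coframe e j) ⊗ₜ[ℝ] (coframe e k * coframe e l) with hF
  have hl : ∀ i j k l, F i j k l = - F j i k l := fun i j k l => by
    simp only [hF]
    rw [coframe, coframe, ι_mul_ι_comm, TensorProduct.neg_tmul]
  have hr : ∀ i j k l, F i j k l = - F i j l k := fun i j k l => by
    simp only [hF]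
    rw [show coframe e k * coframe e l = -(coframe e l * coframe e k) from ι_mul_ι_comm _ _,
      TensorProduct.tmul_neg]
  have hR : metric e * ofBilin e B = ∑ i, ∑ k, ∑ l, B (e k) (e l) • F i k i l := by
    simp only [metric, ofBilin, inner_basis, ite_smul, one_smul, zero_smul, Finset.sum_ite_eq,
      Finset.mem_univ, if_true, Finset.sum_mul]
    simp only [Finset.mul_sum, mul_smul_comm, Algebra.TensorProduct.tmul_mul_tmul, hF]
  have h1 : ∑ i, ∑ j, ∑ k, ∑ l, (inner ℝ (e i) (e k) * B (e j) (e l)) • F i j k l =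
      ∑ i, ∑ k, ∑ l, B (e k) (e l) • F i k i l := by
    refine Finset.sum_congr rfl fun i _ => Finset.sum_congr rfl fun j _ => ?_
    simp [inner_basis, ite_smul, Finset.sum_ite_irrel]
  have h2 : ∑ i, ∑ j, ∑ k, ∑ l, (inner ℝ (e j) (e l) * B (e i) (e k)) • F i j k l =
      ∑ i, ∑ k, ∑ l, B (e k) (e l) • F i k i l := by
    rw [Finset.sum_comm]
    refine Finset.sum_congr rfl fun i _ => Finset.sum_congr rfl fun j _ =>
      Finset.sum_congr rfl fun k _ => ?_
    simp only [inner_basis, ite_mul, one_mul, zero_mul, ite_smul, zero_smul, Finset.sum_ite_eq,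
      Finset.mem_univ, if_true]
    rw [hl, hr, neg_neg]
  have h3 : ∑ i, ∑ j, ∑ k, ∑ l, (inner ℝ (e i) (e l) * B (e j) (e k)) • F i j k l =
      -∑ i, ∑ k, ∑ l, B (e k) (e l) • F i k i l := by
    simp only [← Finset.sum_neg_distrib]
    refine Finset.sum_congr rfl fun i _ => Finset.sum_congr rfl fun j _ =>
      Finset.sum_congr rfl fun k _ => ?_
    simp only [inner_basis, ite_mul, one_mul, zero_mul, ite_smul, zero_smul, Finset.sum_ite_eq,
      Finset.mem_univ, if_true]
    rw [hr, smul_neg]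
  have h4 : ∑ i, ∑ j, ∑ k, ∑ l, (inner ℝ (e j) (e k) * B (e i) (e l)) • F i j k l =
      -∑ i, ∑ k, ∑ l, B (e k) (e l) • F i k i l := by
    simp only [← Finset.sum_neg_distrib]
    rw [Finset.sum_comm]
    refine Finset.sum_congr rfl fun i _ => Finset.sum_congr rfl fun j _ => ?_
    rw [Finset.sum_comm]
    refine Finset.sum_congr rfl fun k _ => ?_
    simp only [inner_basis, ite_mul, one_mul, zero_mul, ite_smul, zero_smul, Finset.sum_ite_eq,
      Finset.mem_univ, if_true]
    rw [hl, smul_neg]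
  have h5 : ∑ i, ∑ j, ∑ k, ∑ l, R (e i) (e j) (e k) (e l) • F i j k l =
      (4 : ℝ) • (metric e * ofBilin e B) := by
    simp only [h _ _ _ _, sub_smul, add_smul, Finset.sum_add_distrib, Finset.sum_sub_distrib]
    rw [h1, h2, h3, h4, hR]
    module
  rw [ofCurvature, h5, smul_smul]
  norm_num

theorem IsKulkarniNomizu.ricci_basis (h : IsKulkarniNomizu R B) (i j : Fin n) :
    ricci e R (e i) (e j) = (n - 2) * B (e i) (e j) +
      (∑ k, B (e k) (e k)) * inner ℝ (e i) (e j) := by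
  simp only [ricci, h _ _ _ _, inner_basis, if_true, Finset.sum_sub_distrib,
    Finset.sum_add_distrib, ite_mul, one_mul, zero_mul, Finset.sum_ite_eq', Finset.sum_ite_eq,
    Finset.mem_univ]
  simp [Finset.sum_ite_irrel]
  ring

/-- Here `Ric = (n-2) B + (tr B) g` and `Scal = 2(n-1) tr B`; the Schouten tensor inverts this. -/
theorem IsKulkarniNomizu.operatorMatrix_schouten (h : IsKulkarniNomizu R B) (hn : 3 ≤ n) :
    operatorMatrix e (schouten e R) = operatorMatrix e B := by
  have hn' : (3 : ℝ) ≤ n := by exact_mod_cast hn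
  have h1 : (n : ℝ) - 2 ≠ 0 := by linarith
  have h2 : (n : ℝ) - 1 ≠ 0 := by linarith
  have hs : scal e R = 2 * (n - 1) * ∑ k, B (e k) (e k) := by
    simp only [scal, h.ricci_basis, Finset.sum_add_distrib, inner_basis, if_true, ← Finset.mul_sum]
    simp
    ring
  ext i j
  simp only [operatorMatrix, Matrix.of_apply, schouten, h.ricci_basis, hs]
  field_simp
  ring

open Polynomial in
/-- The generating polynomial of the numbers `⋆ (g^(m-k) b^k w)`. -/
def mixedPoly (M : Matrix (Fin n) (Fin n) ℝ) (W : DForm V) (m : ℕ) : ℝ[X] :=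
  ∑ k ∈ Finset.range (m + 1),
    monomial k (m.choose k * starScalar e (metric e ^ (m - k) * ofMatrix e M ^ k * W))

theorem mixedPoly_coeff (M : Matrix (Fin n) (Fin n) ℝ) (W : DForm V) {m k : ℕ} (hk : k ≤ m) :
    (mixedPoly e M W m).coeff k =
      m.choose k * starScalar e (metric e ^ (m - k) * ofMatrix e M ^ k * W) := by
  rw [mixedPoly, Polynomial.finsetSum_coeff, Finset.sum_eq_single k]
  · rw [Polynomial.coeff_monomial, if_pos rfl]
  · intro j _ hj
    rw [Polynomial.coeff_monomial, if_neg hj]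
  · intro h
    exact absurd (Finset.mem_range.mpr (Nat.lt_succ_of_le hk)) h

theorem mixedPoly_eval (M : Matrix (Fin n) (Fin n) ℝ) (W : DForm V) (m : ℕ) (t : ℝ) :
    (mixedPoly e M W m).eval t = starScalar e (ofMatrix e (1 + t • M) ^ m * W) := by
  rw [ofMatrix_add, add_comm, (commute_ofMatrix e _ _).add_pow, Finset.sum_mul, map_sum, mixedPoly,
    Polynomial.eval_finsetSum]
  refine Finset.sum_congr rfl fun k _ => ?_
  rw [Polynomial.eval_monomial, ofMatrix_smul, smul_pow, metric_eq_ofMatrix,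
    ← ((commute_ofMatrix e M 1).pow_pow k (m - k)).eq, smul_mul_assoc, mul_assoc _ _ W,
    Nat.cast_comm, mul_assoc _ _ W, smul_mul_assoc, map_smul, ← nsmul_eq_mul (_ : ℕ) W,
    mul_smul_comm, map_nsmul, nsmul_eq_mul, smul_eq_mul, mul_assoc (ofMatrix e M ^ k)]
  ring

/-- Coefficient of `t^k` in `⋆(g + tB)^n = n! ∏ (1 + t λ_i)`. -/
theorem starScalar_metric_pow_mul (hB : (operatorMatrix e B).IsHermitian) {k : ℕ} (hk : k ≤ n) :
    n.choose k * starScalar e (metric e ^ (n - k) * ofBilin e B ^ k) =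
      n.factorial * (genPoly (Finset.univ.val.map hB.eigenvalues)).coeff k := by
  have h : mixedPoly e (operatorMatrix e B) 1 n =
      Polynomial.C (n.factorial : ℝ) * genPoly (Finset.univ.val.map hB.eigenvalues) := by
    refine Polynomial.funext fun t => ?_
    rw [mixedPoly_eval, mul_one, starScalar_ofMatrix_pow, hB.det_one_add_smul]
    simp
  have h2 := congrArg (fun p => p.coeff k) h
  simpa only [ofBilin_eq_ofMatrix, mixedPoly_coeff e _ _ hk, Polynomial.coeff_C_mul, mul_one] using h2

theorem exists_starScalar_metric_pow_mul_mul (hB : (operatorMatrix e B).IsHermitian)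
    {x : Fin n → ℝ} (hx : x ≠ 0) (hn : 0 < n) : ∃ w : Fin n → ℝ, w ≠ 0 ∧ ∀ k ≤ n - 1,
      n * ((n - 1).choose k * starScalar e (metric e ^ (n - 1 - k) * ofBilin e B ^ k *
        ofMatrix e (Matrix.vecMulVec x x))) =
      n.factorial * ∑ i, w i ^ 2 *
        (genPoly ((Finset.univ.erase i).val.map hB.eigenvalues)).coeff k := by
  obtain ⟨w, hw, h⟩ := hB.exists_det_one_add_smul_add_vecMulVec x
  refine ⟨w, hw hx, fun k hk => ?_⟩
  have hp : Polynomial.C (n : ℝ) * mixedPoly e (operatorMatrix e B)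
        (ofMatrix e (Matrix.vecMulVec x x)) (n - 1) =
      Polynomial.C (n.factorial : ℝ) * ∑ i, Polynomial.C (w i ^ 2) *
        genPoly ((Finset.univ.erase i).val.map hB.eigenvalues) := by
    -- The rank-one formula is available only where no `1 + t λ_i` vanishes. This excludes finitely
    -- many `t`, so the polynomials still agree.
    refine Polynomial.eq_of_infinite_eval_eq _ _ (Set.Infinite.mono (s := {t : ℝ |
      ∀ i, 1 + t * hB.eigenvalues i ≠ 0}) (fun t ht => ?_) ?_)
    · have h1 := starScalar_pow_mul_vecMulVec e (1 + t • operatorMatrix e B) x hn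
      rw [h t ht, add_sub_cancel_left] at h1
      simp only [Set.mem_ofPred_eq, Polynomial.eval_mul, Polynomial.eval_C, mixedPoly_eval, h1,
        Polynomial.eval_finsetSum]
    · have hfin : {t : ℝ | ∀ i, 1 + t * hB.eigenvalues i ≠ 0}ᶜ.Finite := by
        refine (Set.finite_range fun i => -(hB.eigenvalues i)⁻¹).subset fun t ht => ?_
        simp only [Set.mem_compl_iff, Set.mem_ofPred_eq, not_forall, not_not] at ht
        obtain ⟨i, hi⟩ := ht
        refine ⟨i, ?_⟩
        have h0 : hB.eigenvalues i ≠ 0 := by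
          intro h0
          simp [h0] at hi
        field_simp
        linarith
      exact fun hf => Set.infinite_univ (α := ℝ) (by simpa using hf.union hfin)
  have h2 := congrArg (fun p => p.coeff k) hp
  simpa only [ofBilin_eq_ofMatrix, mixedPoly_coeff e _ _ hk, Polynomial.coeff_C_mul, 
    Polynomial.finsetSum_coeff] using h2

theorem IsKulkarniNomizu.sigma_eq (h : IsKulkarniNomizu R B) (hn : 3 ≤ n)
    (hB : (operatorMatrix e B).IsHermitian) (k : ℕ) :
    sigma e R k = (genPoly (Finset.univ.val.map hB.eigenvalues)).coeff k := by
  rw [sigma, h.operatorMatrix_schouten e hn, hB.roots_charpoly_eq_eigenvalues, genPoly_coeff]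
  rfl

theorem IsKulkarniNomizu.exists_gaussBonnet_eq (h : IsKulkarniNomizu R B)
    (hB : (operatorMatrix e B).IsHermitian) {k : ℕ} (hk : 2 * k ≤ n) :
    ∃ c : ℝ, 0 < c ∧
      gaussBonnet e R k = c * (genPoly (Finset.univ.val.map hB.eigenvalues)).coeff k := by
  have hc : (0 : ℝ) < n.choose k := by exact_mod_cast Nat.choose_pos (by omega)
  refine ⟨1 / ((n - 2 * k).factorial : ℝ) * (n.factorial / n.choose k), by positivity, ?_⟩
  have h1 := starScalar_metric_pow_mul e hB (k := k) (by omega)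
  have h2 : metric e ^ (n - 2 * k) * ofCurvature e R ^ k =
      metric e ^ (n - k) * ofBilin e B ^ k := by
    have hcomm : Commute (metric e) (ofBilin e B) := commute_ofMatrix e _ _
    rw [h.ofCurvature_eq, hcomm.mul_pow, ← mul_assoc, ← pow_add]
    congr 2
    omega
  rw [gaussBonnet, h2, ← starScalar_apply]
  field_simp
  linarith

/-- `T_{2k}` is thus diagonal in an eigenbasis of `B`, with entries proportional to `σ_k` of the
remaining eigenvalues. -/
theorem IsKulkarniNomizu.exists_einsteinLovelock_eq (h : IsKulkarniNomizu R B)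
    (hB : (operatorMatrix e B).IsHermitian) {k : ℕ} (hk : 2 * k < n) {v : V} (hv : v ≠ 0) :
    ∃ c : ℝ, 0 < c ∧ ∃ w : Fin n → ℝ, w ≠ 0 ∧ einsteinLovelock e R k v v = c * ∑ i, w i ^ 2 *
      (genPoly ((Finset.univ.erase i).val.map hB.eigenvalues)).coeff k := by
  have hx : (fun i => inner ℝ (e i) v : Fin n → ℝ) ≠ 0 := by
    intro h0
    refine hv ?_
    rw [← e.sum_repr' v]
    exact Finset.sum_eq_zero fun i _ => by rw [congrFun h0 i, Pi.zero_apply, zero_smul]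
  have hn0 : (0 : ℝ) < n := by exact_mod_cast (by omega : 0 < n)
  obtain ⟨w, hw, h1⟩ := exists_starScalar_metric_pow_mul_mul e hB hx (by omega)
  have hc : (0 : ℝ) < (n - 1).choose k := by exact_mod_cast Nat.choose_pos (by omega)
  refine ⟨1 / ((n - 2 * k - 1).factorial : ℝ) * (n.factorial / (n * (n - 1).choose k)),
    by positivity, w, hw, ?_⟩
  have h3 := h1 k (by omega)
  have h2 : metric e ^ (n - 2 * k - 1) * ofCurvature e R ^ k =
      metric e ^ (n - 1 - k) * ofBilin e B ^ k := by
    have hcomm : Commute (metric e) (ofBilin e B) := commute_ofMatrix e _ _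
    rw [h.ofCurvature_eq, hcomm.mul_pow, ← mul_assoc, ← pow_add]
    congr 2
    omega
  rw [einsteinLovelock, if_neg (by omega), h2, toBilin_star_self]
  field_simp
  linarith

theorem IsKulkarniNomizu.einsteinLovelock_pos (h : IsKulkarniNomizu R B)
    (hB : (operatorMatrix e B).IsHermitian) {k : ℕ} (hk : 2 * k + 2 ≤ n)
    (hpos : ∀ r : ℕ, 1 ≤ r → r ≤ k + 1 → 0 < gaussBonnet e R r) {r : ℕ} (hr : r ≤ k) {v : V}
    (hv : v ≠ 0) : 0 < einsteinLovelock e R r v v := by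
  have hσ : ∀ j ≤ k + 1, 0 < (genPoly (Finset.univ.val.map hB.eigenvalues)).coeff j := by
    intro j hj
    -- The hypotheses start at `h_2`; the missing degree is `σ_0 = 1`.
    rcases Nat.eq_zero_or_pos j with rfl | h0
    · simp [genPoly_coeff_zero]
    · obtain ⟨c, hc, h1⟩ := h.exists_gaussBonnet_eq e hB (k := j) (by omega)
      have h2 := hpos j h0 hj
      rw [h1] at h2
      exact pos_of_mul_pos_right h2 hc.le
  obtain ⟨c, hc, w, hw, h1⟩ := h.exists_einsteinLovelock_eq e hB (k := r) (by omega) hv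
  have hb : ∀ i, 0 < (genPoly ((Finset.univ.erase i).val.map hB.eigenvalues)).coeff r := by
    intro i
    refine genPoly_coeff_pos_of_cons (hB.eigenvalues i) _ k ?_ r hr
    rw [← Multiset.map_cons, ← Finset.insert_val_of_notMem (Finset.notMem_erase i _),
      Finset.insert_erase (Finset.mem_univ i)]
    exact hσ
  obtain ⟨i, hi⟩ := Function.ne_iff.mp hw
  rw [h1]
  refine mul_pos hc (Finset.sum_pos' (fun j _ => mul_nonneg (sq_nonneg _) (hb j).le)
    ⟨i, Finset.mem_univ i, mul_pos (pow_two_pos_of_ne_zero hi) (hb i)⟩)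

end DoubleForm

/-! ### Conformal change of the curvature tensor in coordinates. -/

namespace Coord

open Filter Topology

variable {n : ℕ}

section Calculus

variable {f h : EuclideanSpace ℝ (Fin n) → ℝ} {y : EuclideanSpace ℝ (Fin n)}

theorem partialDeriv_congr (hfh : f =ᶠ[𝓝 y] h) (i : Fin n) :
    partialDeriv i f y = partialDeriv i h y := by
  rw [partialDeriv, partialDeriv, hfh.fderiv_eq]

theorem partialDeriv_add (hf : DifferentiableAt ℝ f y) (hh : DifferentiableAt ℝ h y) (i : Fin n) :
    partialDeriv i (fun z => f z + h z) y = partialDeriv i f y + partialDeriv i h y := by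
  simp only [partialDeriv]
  rw [fderiv_fun_add hf hh]
  rfl

theorem partialDeriv_sub (hf : DifferentiableAt ℝ f y) (hh : DifferentiableAt ℝ h y) (i : Fin n) :
    partialDeriv i (fun z => f z - h z) y = partialDeriv i f y - partialDeriv i h y := by
  simp only [partialDeriv]
  rw [fderiv_fun_sub hf hh]
  rfl

theorem partialDeriv_mul (hf : DifferentiableAt ℝ f y) (hh : DifferentiableAt ℝ h y) (i : Fin n) :
    partialDeriv i (fun z => f z * h z) y =
      partialDeriv i f y * h y + f y * partialDeriv i h y := by
  simp only [partialDeriv]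
  rw [fderiv_fun_mul hf hh]
  simp only [add_apply, smul_apply, smul_eq_mul]
  ring

theorem partialDeriv_const_mul (hf : DifferentiableAt ℝ f y) (c : ℝ) (i : Fin n) :
    partialDeriv i (fun z => c * f z) y = c * partialDeriv i f y := by
  simp only [partialDeriv]
  rw [fderiv_const_mul hf]
  rfl

theorem partialDeriv_sum {ι : Type*} (s : Finset ι) {u : ι → EuclideanSpace ℝ (Fin n) → ℝ}
    (hu : ∀ a ∈ s, DifferentiableAt ℝ (u a) y) (i : Fin n) :
    partialDeriv i (fun z => ∑ a ∈ s, u a z) y = ∑ a ∈ s, partialDeriv i (u a) y := by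
  simp only [partialDeriv]
  rw [fderiv_fun_sum hu]
  simp

theorem partialDeriv_exp_two_mul (hf : DifferentiableAt ℝ f y) (i : Fin n) :
    partialDeriv i (fun z => Real.exp (2 * f z)) y =
      Real.exp (2 * f y) * (2 * partialDeriv i f y) := by
  simp only [partialDeriv]
  rw [fderiv_exp (hf.const_mul 2), fderiv_const_mul hf]
  rfl

theorem contDiffAt_partialDeriv (hf : ContDiffAt ℝ ∞ f y) (i : Fin n) :
    ContDiffAt ℝ ∞ (partialDeriv i f) y :=
  (hf.fderiv_right (m := ∞) (by simp)).clm_apply contDiffAt_const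

theorem partialDeriv_comm (hf : ContDiffAt ℝ ∞ f y) (i j : Fin n) :
    partialDeriv i (partialDeriv j f) y = partialDeriv j (partialDeriv i f) y := by
  have hd : DifferentiableAt ℝ (fderiv ℝ f) y :=
    (hf.fderiv_right (m := ∞) (by simp)).differentiableAt (by simp)
  have h1 : ∀ a b : Fin n, partialDeriv a (partialDeriv b f) y =
      fderiv ℝ (fderiv ℝ f) y (EuclideanSpace.single a 1) (EuclideanSpace.single b 1) := by
    intro a b
    change fderiv ℝ (fun z => fderiv ℝ f z (EuclideanSpace.single b 1)) y _ = _
    rw [fderiv_clm_apply hd (differentiableAt_const _)]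
    simp
  rw [h1, h1]
  have hs : IsSymmSndFDerivAt ℝ f y := hf.isSymmSndFDerivAt (by
    simpa using (WithTop.coe_le_coe.mpr le_top : ((2 : ℕ∞) : WithTop ℕ∞) ≤ ∞))
  exact hs _ _

theorem contDiffAt_det {m : ℕ} {A : EuclideanSpace ℝ (Fin n) → Matrix (Fin m) (Fin m) ℝ}
    (hA : ∀ i j, ContDiffAt ℝ ∞ (fun z => A z i j) y) : ContDiffAt ℝ ∞ (fun z => (A z).det) y := by
  simp only [Matrix.det_apply]
  exact ContDiffAt.sum fun σ _ => (contDiffAt_prod fun i _ => hA _ _).const_smul _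

theorem contDiffAt_inv_apply {A : EuclideanSpace ℝ (Fin n) → Matrix (Fin n) (Fin n) ℝ}
    (hA : ∀ i j, ContDiffAt ℝ ∞ (fun z => A z i j) y) (hy : (A y).det ≠ 0) (i j : Fin n) :
    ContDiffAt ℝ ∞ (fun z => (A z)⁻¹ i j) y := by
  simp only [Matrix.inv_def, Matrix.smul_apply, Ring.inverse_eq_inv', smul_eq_mul,
    Matrix.adjugate_apply]
  refine ((contDiffAt_det hA).inv hy).mul (contDiffAt_det fun k l => ?_)
  rcases eq_or_ne k j with rfl | h
  · simpa using contDiffAt_const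
  · simpa [h] using hA k l

end Calculus

section Algebra

variable (g : Matrix (Fin n) (Fin n) ℝ) (φ V : Fin n → ℝ)

/-- The difference of the Christoffel symbols of `e^{2f} g` and `g`, where `φ = df` and `V` is the
gradient of `f`. -/
def christoffelDiff (k i j : Fin n) : ℝ :=
  (if k = j then 1 else 0) * φ i + (if k = i then 1 else 0) * φ j - g i j * V k

theorem sum_mul_christoffelDiff (a : Fin n → ℝ) (j q : Fin n) :
    ∑ m, a m * christoffelDiff g φ V m j q = a q * φ j + a j * φ q - g j q * ∑ m, a m * V m := by
  have : ∀ m, a m * christoffelDiff g φ V m j q = (if m = q then a m else 0) * φ j +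
      (if m = j then a m else 0) * φ q - g j q * (a m * V m) := by
    intro m
    rw [christoffelDiff]
    split_ifs <;> ring
  simp only [this, Finset.sum_sub_distrib, Finset.sum_add_distrib, ← Finset.sum_mul,
    ← Finset.mul_sum, Finset.sum_ite_eq', Finset.mem_univ, if_true]

theorem sum_christoffelDiff_mul (a : Fin n → ℝ) (l i : Fin n) :
    ∑ m, christoffelDiff g φ V l i m * a m = φ i * a l +
      (if l = i then 1 else 0) * ∑ m, φ m * a m - V l * ∑ m, g i m * a m := by
  have : ∀ m, christoffelDiff g φ V l i m * a m = φ i * (if l = m then a m else 0) +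
      (if l = i then 1 else 0) * (φ m * a m) - V l * (g i m * a m) := by
    intro m
    rw [christoffelDiff]
    split_ifs <;> ring
  simp only [this, Finset.sum_sub_distrib, Finset.sum_add_distrib, ← Finset.mul_sum,
    Finset.sum_ite_eq, Finset.mem_univ, if_true]

variable {g φ V}

theorem sum_add_christoffelDiff_mul (Γ : Fin n → Fin n → Fin n → ℝ)
    (hV : ∀ p, ∑ l, g p l * V l = φ p) (l i j q : Fin n) :
    ∑ m, (Γ l i m + christoffelDiff g φ V l i m) * (Γ m j q + christoffelDiff g φ V m j q) =
      ∑ m, Γ l i m * Γ m j q +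
      (Γ l i q * φ j + Γ l i j * φ q - g j q * ∑ m, Γ l i m * V m) +
      (φ i * Γ l j q + (if l = i then 1 else 0) * ∑ m, φ m * Γ m j q -
        V l * ∑ m, g i m * Γ m j q) +
      (christoffelDiff g φ V l i q * φ j + christoffelDiff g φ V l i j * φ q - g j q *
        (φ i * V l + (if l = i then 1 else 0) * ∑ m, φ m * V m - V l * φ i)) := by
  simp only [add_mul, mul_add, Finset.sum_add_distrib]
  rw [sum_mul_christoffelDiff, sum_mul_christoffelDiff, sum_christoffelDiff_mul,
    sum_christoffelDiff_mul, hV]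
  ring

/-- The change of the curvature tensor under a conformal change of the metric, with all derivatives
at the given point as data. -/
theorem sum_curvature_christoffelDiff (hg : ∀ i j, g i j = g j i)
    (Γ : Fin n → Fin n → Fin n → ℝ) (hΓ : ∀ k i j, Γ k i j = Γ k j i)
    (hV : ∀ p, ∑ l, g p l * V l = φ p) (dg : Fin n → Fin n → Fin n → ℝ)
    (hdg : ∀ i j k, dg i j k = ∑ m, g k m * Γ m i j + ∑ m, g j m * Γ m i k)
    (dφ dV : Fin n → Fin n → ℝ) (hdφ : ∀ i j, dφ i j = dφ j i)
    (hdV : ∀ i p, dφ i p = ∑ l, dg i p l * V l + ∑ l, g p l * dV i l) (i j p q : Fin n) :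
    ∑ l, g l p * (
      ((if l = q then 1 else 0) * dφ i j + (if l = j then 1 else 0) * dφ i q -
        (dg i j q * V l + g j q * dV i l)) -
      ((if l = q then 1 else 0) * dφ j i + (if l = i then 1 else 0) * dφ j q -
        (dg j i q * V l + g i q * dV j l)) +
      (∑ m, (Γ l i m + christoffelDiff g φ V l i m) * (Γ m j q + christoffelDiff g φ V m j q) -
        ∑ m, Γ l i m * Γ m j q) -
      (∑ m, (Γ l j m + christoffelDiff g φ V l j m) * (Γ m i q + christoffelDiff g φ V m i q) -
        ∑ m, Γ l j m * Γ m i q)) =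
    g j p * (dφ i q - ∑ m, φ m * Γ m i q - φ i * φ q + (∑ m, φ m * V m) * g i q) -
      g i p * (dφ j q - ∑ m, φ m * Γ m j q - φ j * φ q + (∑ m, φ m * V m) * g j q) +
      φ p * (φ i * g j q - φ j * g i q) - g j q * (dφ i p - ∑ m, φ m * Γ m i p) +
      g i q * (dφ j p - ∑ m, φ m * Γ m j p) := by
  -- By metric compatibility, lowering the index of the covariant derivative of the gradient gives
  -- the Hessian.
  have hH : ∀ i p, ∑ l, g l p * (dV i l + ∑ m, Γ l i m * V m) = dφ i p - ∑ m, φ m * Γ m i p := by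
    intro i p
    have h1 : ∑ l, (∑ m, g l m * Γ m i p) * V l = ∑ m, φ m * Γ m i p := by
      simp only [← hV, Finset.sum_mul]
      rw [Finset.sum_comm]
      refine Finset.sum_congr rfl fun m _ => Finset.sum_congr rfl fun l _ => ?_
      rw [hg l m]
      ring
    have h2 : ∑ l, (∑ m, g p m * Γ m i l) * V l = ∑ l, g l p * ∑ m, Γ l i m * V m := by
      simp only [Finset.sum_mul, Finset.mul_sum]
      rw [Finset.sum_comm]
      refine Finset.sum_congr rfl fun m _ => Finset.sum_congr rfl fun l _ => ?_
      rw [hg p m]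
      ring
    simp only [hdV, hdg, add_mul, Finset.sum_add_distrib, mul_add, h1, h2]
    simp only [fun l => hg l p]
    ring
  have hD : ∀ a b : ℝ, ∀ c : ℝ, ∀ l, g l p * ((if l = j then 1 else 0) * a +
      (if l = i then 1 else 0) * b + V l * c - g j q * (dV i l + ∑ m, Γ l i m * V m) +
      g i q * (dV j l + ∑ m, Γ l j m * V m)) =
      (if l = j then g l p else 0) * a + (if l = i then g l p else 0) * b + (g p l * V l) * c -
      g j q * (g l p * (dV i l + ∑ m, Γ l i m * V m)) +
      g i q * (g l p * (dV j l + ∑ m, Γ l j m * V m)) := by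
    intro a b c l
    rw [hg p l]
    split_ifs <;> ring
  have hsum : ∀ a b c : ℝ, ∑ l, g l p * ((if l = j then 1 else 0) * a +
      (if l = i then 1 else 0) * b + V l * c - g j q * (dV i l + ∑ m, Γ l i m * V m) +
      g i q * (dV j l + ∑ m, Γ l j m * V m)) = g j p * a + g i p * b + φ p * c -
      g j q * (dφ i p - ∑ m, φ m * Γ m i p) + g i q * (dφ j p - ∑ m, φ m * Γ m j p) := by
    intro a b c
    simp only [hD, Finset.sum_sub_distrib, Finset.sum_add_distrib, ← Finset.sum_mul,
      ← Finset.mul_sum, Finset.sum_ite_eq', Finset.mem_univ, if_true, hV, hH]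
  have key := hsum (dφ i q - ∑ m, φ m * Γ m i q - φ i * φ q + (∑ m, φ m * V m) * g i q)
    (-(dφ j q - ∑ m, φ m * Γ m j q - φ j * φ q + (∑ m, φ m * V m) * g j q))
    (φ i * g j q - φ j * g i q)
  rw [mul_neg, ← sub_eq_add_neg] at key
  rw [← key]
  refine Finset.sum_congr rfl fun l _ => ?_
  congr 1
  rw [sum_add_christoffelDiff_mul Γ hV, sum_add_christoffelDiff_mul Γ hV, hdg, hdg, hdφ j i,
    hΓ l j i]
  simp only [fun m => hΓ m j i]
  simp only [christoffelDiff, hg j i]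
  ring

end Algebra

section Conformal

variable {g : EuclideanSpace ℝ (Fin n) → Matrix (Fin n) (Fin n) ℝ}
  {f : EuclideanSpace ℝ (Fin n) → ℝ} {y : EuclideanSpace ℝ (Fin n)}

theorem sum_mul_inv_apply (hdet : (g y).det ≠ 0) (u : Fin n → ℝ) (p : Fin n) :
    ∑ k, g y p k * ∑ l, (g y)⁻¹ k l * u l = u p := by
  have h : g y * (g y)⁻¹ = 1 := Matrix.mul_nonsing_inv _ (isUnit_iff_ne_zero.mpr hdet)
  have h2 : (g y).mulVec ((g y)⁻¹.mulVec u) = u := by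
    rw [Matrix.mulVec_mulVec, h, Matrix.one_mulVec]
  exact congrFun h2 p

theorem sum_inv_mul_apply (hdet : (g y).det ≠ 0) (k p : Fin n) :
    ∑ l, (g y)⁻¹ k l * g y l p = if k = p then 1 else 0 := by
  have h : (g y)⁻¹ * g y = 1 := Matrix.nonsing_inv_mul _ (isUnit_iff_ne_zero.mpr hdet)
  rw [← Matrix.mul_apply, h, Matrix.one_apply]

theorem christoffel_comm (hsymm : ∀ᶠ z in 𝓝 y, (g z).IsSymm) (k i j : Fin n) :
    christoffel g k i j y = christoffel g k j i y := by
  have h : ∀ l, partialDeriv l (fun z => g z i j) y = partialDeriv l (fun z => g z j i) y :=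
    fun l => partialDeriv_congr (hsymm.mono fun z hz => hz.apply j i) l
  simp only [christoffel, h]
  congr 1
  refine Finset.sum_congr rfl fun l _ => ?_
  ring

/-- Compatibility of the Levi-Civita connection with the metric. -/
theorem partialDeriv_metric (hsymm : ∀ᶠ z in 𝓝 y, (g z).IsSymm) (hdet : (g y).det ≠ 0)
    (i j k : Fin n) : partialDeriv i (fun z => g z j k) y =
      ∑ m, g y k m * christoffel g m i j y + ∑ m, g y j m * christoffel g m i k y := by
  have h : ∀ l a b, partialDeriv l (fun z => g z a b) y = partialDeriv l (fun z => g z b a) y :=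
    fun l a b => partialDeriv_congr (hsymm.mono fun z hz => hz.apply b a) l
  have h1 : ∀ p a b, ∑ m, g y p m * christoffel g m a b y =
      (1 / 2 : ℝ) * (partialDeriv a (fun z => g z b p) y + partialDeriv b (fun z => g z a p) y
        - partialDeriv p (fun z => g z a b) y) := by
    intro p a b
    rw [← sum_mul_inv_apply hdet (fun p => partialDeriv a (fun z => g z b p) y +
      partialDeriv b (fun z => g z a p) y - partialDeriv p (fun z => g z a b) y) p, Finset.mul_sum]
    refine Finset.sum_congr rfl fun m _ => ?_
    rw [christoffel]
    ring
  rw [h1, h1, h i k j, h j i k, h k i j]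
  ring

theorem contDiffAt_christoffel (hg : ∀ i j, ContDiffAt ℝ ∞ (fun z => g z i j) y)
    (hdet : (g y).det ≠ 0) (k i j : Fin n) : ContDiffAt ℝ ∞ (christoffel g k i j) y := by
  refine contDiffAt_const.mul (ContDiffAt.sum fun l _ => ?_)
  exact (contDiffAt_inv_apply hg hdet k l).mul (((contDiffAt_partialDeriv (hg j l) i).add
    (contDiffAt_partialDeriv (hg i l) j)).sub (contDiffAt_partialDeriv (hg i j) l))

/-- The gradient of `f`. -/
def grad (g : EuclideanSpace ℝ (Fin n) → Matrix (Fin n) (Fin n) ℝ)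
    (f : EuclideanSpace ℝ (Fin n) → ℝ) (k : Fin n) (y : EuclideanSpace ℝ (Fin n)) : ℝ :=
  ∑ l, (g y)⁻¹ k l * partialDeriv l f y

theorem contDiffAt_grad (hg : ∀ i j, ContDiffAt ℝ ∞ (fun z => g z i j) y)
    (hdet : (g y).det ≠ 0) (hf : ContDiffAt ℝ ∞ f y) (k : Fin n) :
    ContDiffAt ℝ ∞ (grad g f k) y :=
  ContDiffAt.sum fun l _ => (contDiffAt_inv_apply hg hdet k l).mul (contDiffAt_partialDeriv hf l)

/-- The factor `e^{2f}` cancels against the inverse metric, so only the derivatives of `f` leave a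
trace. -/
theorem christoffel_conformal (hg : ∀ i j, DifferentiableAt ℝ (fun z => g z i j) y)
    (hf : DifferentiableAt ℝ f y) (hsymm : (g y).IsSymm) (hdet : (g y).det ≠ 0) (k i j : Fin n) :
    christoffel (fun z => Real.exp (2 * f z) • g z) k i j y = christoffel g k i j y +
      christoffelDiff (g y) (fun l => partialDeriv l f y) (fun l => grad g f l y) k i j := by
  have h1 : ∀ l a b, partialDeriv l (fun z => Real.exp (2 * f z) * g z a b) y =
      Real.exp (2 * f y) * (partialDeriv l (fun z => g z a b) y +
        2 * partialDeriv l f y * g y a b) := by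
    intro l a b
    rw [partialDeriv_mul (hf.const_mul 2).exp (hg a b), partialDeriv_exp_two_mul hf]
    ring
  have h2 : (Real.exp (2 * f y) • g y)⁻¹ = (Real.exp (2 * f y))⁻¹ • (g y)⁻¹ := by
    refine Matrix.inv_eq_right_inv ?_
    rw [Matrix.smul_mul, Matrix.mul_smul, smul_smul, mul_inv_cancel₀ (Real.exp_ne_zero _), one_smul,
      Matrix.mul_nonsing_inv _ (isUnit_iff_ne_zero.mpr hdet)]
  have h3 : ∀ l, (Real.exp (2 * f y))⁻¹ * (g y)⁻¹ k l *
      (Real.exp (2 * f y) * (partialDeriv i (fun z => g z j l) y + 2 * partialDeriv i f y * g y j l)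
      + Real.exp (2 * f y) * (partialDeriv j (fun z => g z i l) y + 2 * partialDeriv j f y * g y i l)
      - Real.exp (2 * f y) *
        (partialDeriv l (fun z => g z i j) y + 2 * partialDeriv l f y * g y i j)) =
      (g y)⁻¹ k l * (partialDeriv i (fun z => g z j l) y + partialDeriv j (fun z => g z i l) y
        - partialDeriv l (fun z => g z i j) y) +
      2 * partialDeriv i f y * ((g y)⁻¹ k l * g y l j) +
      2 * partialDeriv j f y * ((g y)⁻¹ k l * g y l i) -
      2 * g y i j * ((g y)⁻¹ k l * partialDeriv l f y) := by
    intro l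
    have he := Real.exp_ne_zero (2 * f y)
    rw [hsymm.apply j l, hsymm.apply i l]
    field_simp
    ring
  simp only [christoffel, h2, Matrix.smul_apply, smul_eq_mul]
  simp only [h1, h3, Finset.sum_sub_distrib, Finset.sum_add_distrib, ← Finset.mul_sum,
    sum_inv_mul_apply hdet, christoffelDiff, grad]
  ring

/-- If `e^{2f} g` is flat then the curvature of `g` is a Kulkarni–Nomizu product with `g`. -/
theorem exists_curvature_eq (hg : ∀ᶠ z in 𝓝 y, ∀ i j, ContDiffAt ℝ ∞ (fun w => g w i j) z)
    (hf : ∀ᶠ z in 𝓝 y, ContDiffAt ℝ ∞ f z) (hsymm : ∀ᶠ z in 𝓝 y, (g z).IsSymm)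
    (hdet : ∀ᶠ z in 𝓝 y, (g z).det ≠ 0)
    (hflat : ∀ i j p q, curvature (fun z => Real.exp (2 * f z) • g z) i j p q y = 0) :
    ∃ B : Matrix (Fin n) (Fin n) ℝ, B.IsSymm ∧ ∀ i j p q, curvature g i j p q y =
      g y i p * B j q + g y j q * B i p - g y i q * B j p - g y j p * B i q := by
  have hg0 := hg.self_of_nhds
  have hf0 := hf.self_of_nhds
  have hs0 := hsymm.self_of_nhds
  have hd0 := hdet.self_of_nhds
  have hne : (∞ : WithTop ℕ∞) ≠ 0 := by simp
  set φ : Fin n → ℝ := fun l => partialDeriv l f y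
  set V : Fin n → ℝ := fun l => grad g f l y
  set Γ : Fin n → Fin n → Fin n → ℝ := fun k i j => christoffel g k i j y
  have hV : ∀ p, ∑ l, g y p l * V l = φ p := fun p => sum_mul_inv_apply hd0 φ p
  have hΓ : ∀ k i j, Γ k i j = Γ k j i := fun k i j => christoffel_comm hsymm k i j
  -- The identity is needed near `y`, since it is differentiated next.
  have hchr : ∀ k i j, christoffel (fun z => Real.exp (2 * f z) • g z) k i j =ᶠ[𝓝 y] fun z =>
      christoffel g k i j z + ((if k = j then 1 else 0) * partialDeriv i f z +
        (if k = i then 1 else 0) * partialDeriv j f z - g z i j * grad g f k z) := by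
    intro k i j
    filter_upwards [hg, hf, hsymm, hdet] with z h1 h2 h3 h4
    exact christoffel_conformal (fun a b => (h1 a b).differentiableAt hne)
      (h2.differentiableAt hne) h3 h4 k i j
  have hdchr : ∀ l k i j, partialDeriv l (christoffel (fun z => Real.exp (2 * f z) • g z) k i j) y =
      partialDeriv l (christoffel g k i j) y +
        ((if k = j then 1 else 0) * partialDeriv l (partialDeriv i f) y +
        (if k = i then 1 else 0) * partialDeriv l (partialDeriv j f) y -
        (partialDeriv l (fun z => g z i j) y * V k + g y i j * partialDeriv l (grad g f k) y)) := by
    intro l k i j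
    have d1 := (contDiffAt_christoffel hg0 hd0 k i j).differentiableAt hne
    have d2 := (contDiffAt_partialDeriv hf0 i).differentiableAt hne
    have d3 := (contDiffAt_partialDeriv hf0 j).differentiableAt hne
    have d4 := (hg0 i j).differentiableAt hne
    have d5 := (contDiffAt_grad hg0 hd0 hf0 k).differentiableAt hne
    rw [partialDeriv_congr (hchr k i j), partialDeriv_add d1
      (((d2.const_mul _).fun_add (d3.const_mul _)).fun_sub (d4.fun_mul d5)),
      partialDeriv_sub ((d2.const_mul _).fun_add (d3.const_mul _)) (d4.fun_mul d5),
      partialDeriv_add (d2.const_mul _) (d3.const_mul _), partialDeriv_const_mul d2,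
      partialDeriv_const_mul d3, partialDeriv_mul d4 d5]
  have hdV : ∀ i p, partialDeriv i (partialDeriv p f) y =
      ∑ l, partialDeriv i (fun z => g z p l) y * V l +
        ∑ l, g y p l * partialDeriv i (grad g f l) y := by
    intro i p
    have h1 : partialDeriv p f =ᶠ[𝓝 y] fun z => ∑ l, g z p l * grad g f l z :=
      hdet.mono fun z hz => (sum_mul_inv_apply hz (fun l => partialDeriv l f z) p).symm
    have d4 := fun l => (hg0 p l).differentiableAt hne
    have d5 := fun l => (contDiffAt_grad hg0 hd0 hf0 l).differentiableAt hne
    rw [partialDeriv_congr h1, partialDeriv_sum _ fun l _ => (d4 l).fun_mul (d5 l),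
      ← Finset.sum_add_distrib]
    exact Finset.sum_congr rfl fun l _ => partialDeriv_mul (d4 l) (d5 l) i
  have halg := sum_curvature_christoffelDiff (fun i j => hs0.apply j i) Γ hΓ hV
    (fun i j k => partialDeriv i (fun z => g z j k) y)
    (fun i j k => partialDeriv_metric hsymm hd0 i j k)
    (fun i j => partialDeriv i (partialDeriv j f) y)
    (fun i l => partialDeriv i (grad g f l) y) (fun i j => partialDeriv_comm hf0 i j) hdV
  have hchr0 : ∀ k i j, christoffel (fun z => Real.exp (2 * f z) • g z) k i j y =
      Γ k i j + christoffelDiff (g y) φ V k i j := fun k i j => (hchr k i j).self_of_nhds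
  set H : Fin n → Fin n → ℝ := fun i j =>
    partialDeriv i (partialDeriv j f) y - ∑ m, φ m * Γ m i j with hH
  have hHs : ∀ i j, H i j = H j i := by
    intro i j
    simp only [hH]
    rw [partialDeriv_comm hf0 i j]
    simp only [fun m => hΓ m i j]
  -- This is `Hess f - df ⊗ df + (|df|²/2) g`, read off from the conformal change formula. The half
  -- appears because the Kulkarni–Nomizu product of `g` with itself counts each term twice.
  refine ⟨Matrix.of fun i j => H i j - φ i * φ j + (∑ m, φ m * V m) / 2 * g y i j, ?_, ?_⟩
  · ext i j
    simp only [Matrix.transpose_apply, Matrix.of_apply]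
    rw [hHs j i, hs0.apply i j]
    ring
  · intro i j p q
    have h1 := hflat i j p q
    have h2 : curvature (fun z => Real.exp (2 * f z) • g z) i j p q y =
        Real.exp (2 * f y) * (curvature g i j p q y +
          (g y j p * (H i q - φ i * φ q + (∑ m, φ m * V m) * g y i q) -
            g y i p * (H j q - φ j * φ q + (∑ m, φ m * V m) * g y j q) +
            φ p * (φ i * g y j q - φ j * g y i q) - g y j q * H i p + g y i q * H j p)) := by
      rw [← halg i j p q, curvature, curvature, ← Finset.sum_add_distrib, Finset.mul_sum]
      refine Finset.sum_congr rfl fun l _ => ?_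
      simp only [curvatureUp, hdchr, hchr0, Finset.sum_sub_distrib, Matrix.smul_apply, smul_eq_mul]
      ring
    rw [h2] at h1
    have h3 := (mul_eq_zero.mp h1).resolve_left (Real.exp_ne_zero _)
    simp only [Matrix.of_apply]
    linear_combination h3

end Conformal

end Coord

/-! ### From chart components to tensors on tangent spaces. -/

theorem sum_mul_sum_eq_sum_four {ι : Type*} [Fintype ι] (a b c d : ι → ℝ) (X Y : Matrix ι ι ℝ) :
    (∑ i, ∑ p, a i * c p * X i p) * (∑ j, ∑ q, b j * d q * Y j q) =
      ∑ i, ∑ j, ∑ p, ∑ q, a i * b j * c p * d q * (X i p * Y j q) := by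
  rw [Finset.sum_mul_sum]
  refine Finset.sum_congr rfl fun i _ => Finset.sum_congr rfl fun j _ => ?_
  rw [Finset.sum_mul_sum]
  refine Finset.sum_congr rfl fun p _ => Finset.sum_congr rfl fun q _ => ?_
  ring

theorem sum_mul_sum_eq_sum_four' {ι : Type*} [Fintype ι] (a b c d : ι → ℝ) (X Y : Matrix ι ι ℝ) :
    (∑ i, ∑ q, a i * d q * X i q) * (∑ j, ∑ p, b j * c p * Y j p) =
      ∑ i, ∑ j, ∑ p, ∑ q, a i * b j * c p * d q * (X i q * Y j p) := by
  rw [sum_mul_sum_eq_sum_four]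
  refine Finset.sum_congr rfl fun i _ => Finset.sum_congr rfl fun j _ => ?_
  rw [Finset.sum_comm]
  refine Finset.sum_congr rfl fun p _ => Finset.sum_congr rfl fun q _ => ?_
  ring

theorem sum_kulkarniNomizu {ι : Type*} [Fintype ι] (a b c d : ι → ℝ) (X Y : Matrix ι ι ℝ) :
    ∑ i, ∑ j, ∑ p, ∑ q, a i * b j * c p * d q *
      (X i p * Y j q + X j q * Y i p - X i q * Y j p - X j p * Y i q) =
    (∑ i, ∑ p, a i * c p * X i p) * (∑ j, ∑ q, b j * d q * Y j q) +
      (∑ j, ∑ q, b j * d q * X j q) * (∑ i, ∑ p, a i * c p * Y i p) -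
      (∑ i, ∑ q, a i * d q * X i q) * (∑ j, ∑ p, b j * c p * Y j p) -
      (∑ j, ∑ p, b j * c p * X j p) * (∑ i, ∑ q, a i * d q * Y i q) := by
  rw [mul_comm (∑ j, ∑ q, b j * d q * X j q), mul_comm (∑ j, ∑ p, b j * c p * X j p),
    sum_mul_sum_eq_sum_four, sum_mul_sum_eq_sum_four, sum_mul_sum_eq_sum_four',
    sum_mul_sum_eq_sum_four']
  simp only [← Finset.sum_add_distrib, ← Finset.sum_sub_distrib]
  refine Finset.sum_congr rfl fun i _ => Finset.sum_congr rfl fun j _ =>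
    Finset.sum_congr rfl fun p _ => Finset.sum_congr rfl fun q _ => ?_
  ring

namespace RiemGeom

open Filter Topology

variable {n : ℕ} {M : Type*} [TopologicalSpace M] [ChartedSpace (EuclideanSpace ℝ (Fin n)) M]

/-- The derivative of the inverse of the chart at `x`. -/
abbrev chartSymmDeriv (x : M) (y : EuclideanSpace ℝ (Fin n)) :
    EuclideanSpace ℝ (Fin n) →L[ℝ] TangentSpace (𝓡 n) ((extChartAt (𝓡 n) x).symm y) :=
  mfderiv 𝓘(ℝ, EuclideanSpace ℝ (Fin n)) (𝓡 n) (extChartAt (𝓡 n) x).symm y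

section

variable [Bundle.RiemannianBundle (fun x : M => TangentSpace (𝓡 n) x)]

theorem chartMetric_isSymm (x : M) (y : EuclideanSpace ℝ (Fin n)) :
    (chartMetric (metric n M) x y).IsSymm := by
  ext i j
  exact real_inner_comm (F := TangentSpace (𝓡 n) ((extChartAt (𝓡 n) x).symm y)) _ _

theorem sum_chartMetric (x : M) (y a b : EuclideanSpace ℝ (Fin n)) :
    ∑ i, ∑ j, a i * b j * chartMetric (metric n M) x y i j =
      metric n M _ (chartSymmDeriv x y a) (chartSymmDeriv x y b) := by
  have h : ∀ c : EuclideanSpace ℝ (Fin n), chartSymmDeriv x y c =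
      ∑ i, c i • chartSymmDeriv x y (EuclideanSpace.single i (1 : ℝ)) := by
    intro c
    conv_lhs => rw [← (EuclideanSpace.basisFun (Fin n) ℝ).sum_repr c]
    rw [map_sum]
    refine Finset.sum_congr rfl fun i _ => ?_
    rw [map_smul]
    simp
  rw [h a, h b, metric, sum_inner]
  refine Finset.sum_congr rfl fun i _ => ?_
  rw [inner_sum]
  refine Finset.sum_congr rfl fun j _ => ?_
  rw [real_inner_smul_left, real_inner_smul_right, mul_assoc]
  rfl

/-- Going to the chart and back returns `x` only up to a propositional equality, while the tangent
spaces share one underlying type. -/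
theorem metric_congr {p q : M} (h : p = q) (a b : EuclideanSpace ℝ (Fin n)) :
    metric n M p (a : TangentSpace (𝓡 n) p) (b : TangentSpace (𝓡 n) p) =
      metric n M q (a : TangentSpace (𝓡 n) q) (b : TangentSpace (𝓡 n) q) := by
  subst h
  rfl

end

variable [IsManifold (𝓡 n) ∞ M]

theorem chartSymmDeriv_injective {x : M} {y : EuclideanSpace ℝ (Fin n)}
    (hy : y ∈ (extChartAt (𝓡 n) x).target) : Function.Injective (chartSymmDeriv x y) := by
  have : IsManifold (𝓡 n) 1 M := IsManifold.of_le (n := ∞) (by simp)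
  have h := mfderiv_extChartAt_comp_mfderivWithin_extChartAt_symm hy
  rw [ModelWithCorners.range_eq_univ, mfderivWithin_univ] at h
  intro a b hab
  have ha := DFunLike.congr_fun h a
  have hb := DFunLike.congr_fun h b
  exact ha.symm.trans ((congrArg (mfderiv (𝓡 n) 𝓘(ℝ, EuclideanSpace ℝ (Fin n))
    (extChartAt (𝓡 n) x) ((extChartAt (𝓡 n) x).symm y)) hab).trans hb)

theorem coordVec_chartSymmDeriv (x : M) (a : EuclideanSpace ℝ (Fin n)) :
    coordVec x (chartSymmDeriv x (extChartAt (𝓡 n) x x) a) = a := by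
  have : IsManifold (𝓡 n) 1 M := IsManifold.of_le (n := ∞) (by simp)
  have h := mfderiv_extChartAt_comp_mfderivWithin_extChartAt_symm' (I := 𝓡 n)
    (mem_extChartAt_source (I := 𝓡 n) x)
  rw [ModelWithCorners.range_eq_univ, mfderivWithin_univ] at h
  exact DFunLike.congr_fun h a

theorem chartSymmDeriv_coordVec (x : M) (v : TangentSpace (𝓡 n) x) :
    chartSymmDeriv x (extChartAt (𝓡 n) x x) (coordVec x v) = v := by
  have : IsManifold (𝓡 n) 1 M := IsManifold.of_le (n := ∞) (by simp)
  have h := mfderivWithin_extChartAt_symm_comp_mfderiv_extChartAt' (I := 𝓡 n)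
    (mem_extChartAt_source (I := 𝓡 n) x)
  rw [ModelWithCorners.range_eq_univ, mfderivWithin_univ] at h
  exact DFunLike.congr_fun h v

/-- The tangent map of the inverse chart is applied to a constant vector field; smoothness of the
metric coefficients follows from this. -/
theorem contMDiffOn_chartSymmDeriv (x : M) (a : EuclideanSpace ℝ (Fin n)) :
    ContMDiffOn 𝓘(ℝ, EuclideanSpace ℝ (Fin n)) ((𝓡 n).prod 𝓘(ℝ, EuclideanSpace ℝ (Fin n))) ∞
      (fun y => (⟨(extChartAt (𝓡 n) x).symm y, chartSymmDeriv x y a⟩ : TangentBundle (𝓡 n) M))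
      (extChartAt (𝓡 n) x).target := by
  have hopen : IsOpen (extChartAt (𝓡 n) x).target := isOpen_extChartAt_target x
  have h1 := (contMDiffOn_extChartAt_symm (I := 𝓡 n) (n := ∞) x).contMDiffOn_tangentMapWithin
    (m := ∞) (by simp) hopen.uniqueMDiffOn
  have h2 : ContMDiffOn 𝓘(ℝ, EuclideanSpace ℝ (Fin n))
      (𝓘(ℝ, EuclideanSpace ℝ (Fin n)).prod 𝓘(ℝ, EuclideanSpace ℝ (Fin n))) ∞
      (fun y => (⟨y, a⟩ : TangentBundle 𝓘(ℝ, EuclideanSpace ℝ (Fin n))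
        (EuclideanSpace ℝ (Fin n)))) (extChartAt (𝓡 n) x).target :=
    contMDiffOn_vectorSpace_iff_contDiffOn.mpr contDiffOn_const
  refine (h1.comp h2 fun y hy => hy).congr fun y hy => ?_
  simp only [Function.comp_apply, tangentMapWithin]
  rw [mfderivWithin_of_mem_nhds (hopen.mem_nhds hy)]
  rfl

theorem riemann_chartSymmDeriv (G : ∀ p : M, TangentSpace (𝓡 n) p → TangentSpace (𝓡 n) p → ℝ)
    (x : M) (i j p q : Fin n) :
    riemann G x (chartSymmDeriv x (extChartAt (𝓡 n) x x) (EuclideanSpace.single i (1 : ℝ)))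
      (chartSymmDeriv x (extChartAt (𝓡 n) x x) (EuclideanSpace.single j (1 : ℝ)))
      (chartSymmDeriv x (extChartAt (𝓡 n) x x) (EuclideanSpace.single p (1 : ℝ)))
      (chartSymmDeriv x (extChartAt (𝓡 n) x x) (EuclideanSpace.single q (1 : ℝ))) =
    Coord.curvature (chartMetric G x) i j p q (extChartAt (𝓡 n) x x) := by
  simp only [riemann, coordVec_chartSymmDeriv, PiLp.single_apply, ite_mul, mul_ite, one_mul, mul_one,
    zero_mul, mul_zero, Finset.sum_ite_eq', Finset.mem_univ, if_true]

variable [Bundle.RiemannianBundle (fun x : M => TangentSpace (𝓡 n) x)]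

/-- A null vector of the Gram matrix would map to a tangent vector of length zero, against
injectivity of the derivative. -/
theorem chartMetric_det_ne_zero {x : M} {y : EuclideanSpace ℝ (Fin n)}
    (hy : y ∈ (extChartAt (𝓡 n) x).target) : (chartMetric (metric n M) x y).det ≠ 0 := by
  intro h0
  obtain ⟨v, hv, hv0⟩ := Matrix.exists_mulVec_eq_zero_iff.mpr h0
  set a : EuclideanSpace ℝ (Fin n) := WithLp.toLp 2 v
  have h1 := sum_chartMetric x y a a
  have h2 : ∑ i, ∑ j, a i * a j * chartMetric (metric n M) x y i j = 0 := by
    refine Finset.sum_eq_zero fun i _ => ?_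
    have h3 := congrFun hv0 i
    rw [Matrix.mulVec, dotProduct] at h3
    calc ∑ j, a i * a j * chartMetric (metric n M) x y i j
        = v i * ∑ j, chartMetric (metric n M) x y i j * v j := by
          rw [Finset.mul_sum]
          refine Finset.sum_congr rfl fun j _ => ?_
          change v i * v j * _ = _
          ring
      _ = 0 := by rw [h3]; simp
  rw [h2, metric] at h1
  have h4 := inner_self_eq_zero.mp h1.symm
  have h5 : a = 0 := chartSymmDeriv_injective hy (h4.trans (map_zero _).symm)
  exact hv (congrArg WithLp.ofLp h5)

theorem inner_eq_sum_chartMetric (x : M) (v w : TangentSpace (𝓡 n) x) :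
    inner ℝ v w = ∑ i, ∑ j, coordVec x v i * coordVec x w j *
      chartMetric (metric n M) x (extChartAt (𝓡 n) x x) i j := by
  rw [sum_chartMetric, chartSymmDeriv_coordVec, chartSymmDeriv_coordVec]
  exact metric_congr (extChartAt_to_inv (I := 𝓡 n) x).symm v w

variable [IsContMDiffRiemannianBundle (𝓡 n) ∞ (EuclideanSpace ℝ (Fin n))
  (fun x : M => TangentSpace (𝓡 n) x)]

theorem contDiffAt_chartMetric {x : M} {y : EuclideanSpace ℝ (Fin n)}
    (hy : y ∈ (extChartAt (𝓡 n) x).target) (i j : Fin n) :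
    ContDiffAt ℝ ∞ (fun z => chartMetric (metric n M) x z i j) y := by
  have h := (contMDiffOn_chartSymmDeriv x (EuclideanSpace.single i (1 : ℝ))).inner_bundle
    (contMDiffOn_chartSymmDeriv x (EuclideanSpace.single j (1 : ℝ)))
  exact (h.contDiffOn).contDiffAt ((isOpen_extChartAt_target x).mem_nhds hy)

theorem exists_isKulkarniNomizu (hM : IsConformallyFlat n M) (x : M) :
    ∃ B : TangentSpace (𝓡 n) x → TangentSpace (𝓡 n) x → ℝ, (∀ v w, B v w = B w v) ∧
      DoubleForm.IsKulkarniNomizu (riemann (metric n M) x) B := by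
  obtain ⟨U, hU, hxU, f, hf, hflat⟩ := hM x
  set y := extChartAt (𝓡 n) x x with hy
  have hyt : y ∈ (extChartAt (𝓡 n) x).target := mem_extChartAt_target x
  have hev : ∀ᶠ z in 𝓝 y, z ∈ (extChartAt (𝓡 n) x).target :=
    (isOpen_extChartAt_target x).mem_nhds hyt
  set F : EuclideanSpace ℝ (Fin n) → ℝ := fun z => f ((extChartAt (𝓡 n) x).symm z)
  have hFs : ∀ᶠ z in 𝓝 y, ContDiffAt ℝ ∞ F z := by
    have hcont : ContinuousAt (extChartAt (𝓡 n) x).symm y := continuousAt_extChartAt_symm x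
    have hev2 : ∀ᶠ z in 𝓝 y, (extChartAt (𝓡 n) x).symm z ∈ U := by
      refine hcont.eventually_mem (hU.mem_nhds ?_)
      rwa [hy, extChartAt_to_inv]
    filter_upwards [hev, hev2] with z hz1 hz2
    have h1 := (contMDiffOn_extChartAt_symm (I := 𝓡 n) (n := ∞) x).contMDiffAt
      ((isOpen_extChartAt_target x).mem_nhds hz1)
    exact ((hf.contMDiffAt (hU.mem_nhds hz2)).comp z h1).contDiffAt
  obtain ⟨B, hB, hR⟩ := Coord.exists_curvature_eq (g := chartMetric (metric n M) x) (f := F) (y := y)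
    (hev.mono fun z hz i j => contDiffAt_chartMetric hz i j) hFs
    (Eventually.of_forall fun z => chartMetric_isSymm x z)
    (hev.mono fun z hz => chartMetric_det_ne_zero hz) (by
      intro i j p q
      -- The chart components of `e^{2f} g` are by definition `e^{2F}` times those of `g`.
      exact (riemann_chartSymmDeriv _ x i j p q).symm.trans (hflat x hxU _ _ _ _))
  refine ⟨fun v w => ∑ i, ∑ j, coordVec x v i * coordVec x w j * B i j, fun v w => ?_, ?_⟩
  · beta_reduce
    rw [Finset.sum_comm]
    refine Finset.sum_congr rfl fun i _ => Finset.sum_congr rfl fun j _ => ?_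
    rw [hB.apply i j]
    ring
  · intro u v w z
    simp only [riemann, inner_eq_sum_chartMetric, ← hy, hR]
    exact sum_kulkarniNomizu _ _ _ _ _ _

end RiemGeom

end

theorem mainTheorem12 (n : ℕ) (hn : 3 ≤ n) (M : Type*) [TopologicalSpace M]
    [ChartedSpace (EuclideanSpace ℝ (Fin n)) M] [IsManifold (𝓡 n) ∞ M]
    [Bundle.RiemannianBundle (fun x : M => TangentSpace (𝓡 n) x)]
    [IsContMDiffRiemannianBundle (𝓡 n) ∞ (EuclideanSpace ℝ (Fin n))
      (fun x : M => TangentSpace (𝓡 n) x)]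
    (hM : RiemGeom.IsConformallyFlat n M) (k : ℕ) (hk : 1 ≤ k) :
    (2 * k ≤ n → ∀ x : M, 0 < RiemGeom.sigma n k x ↔ 0 < RiemGeom.gaussBonnet n k x) ∧
    (2 * k + 2 ≤ n → ∀ x : M,
      (∀ r : ℕ, 1 ≤ r → r ≤ k + 1 → 0 < RiemGeom.gaussBonnet n r x) →
      ∀ r : ℕ, 1 ≤ r → r ≤ k → ∀ v : TangentSpace (𝓡 n) x, v ≠ 0 →
        0 < RiemGeom.einsteinLovelock n r x v v) := by
  have key : ∀ x : M, ∃ B : TangentSpace (𝓡 n) x → TangentSpace (𝓡 n) x → ℝ,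
      (DoubleForm.operatorMatrix (RiemGeom.frame n x) B).IsHermitian ∧
        DoubleForm.IsKulkarniNomizu (RiemGeom.riemann (RiemGeom.metric n M) x) B := by
    intro x
    obtain ⟨B, hs, h⟩ := RiemGeom.exists_isKulkarniNomizu hM x
    refine ⟨B, ?_, h⟩
    ext i j
    exact hs _ _
  refine ⟨fun hk2 x => ?_, fun hk2 x hpos r _ hr v hv => ?_⟩
  · obtain ⟨B, hB, h⟩ := key x
    obtain ⟨c, hc, h1⟩ := h.exists_gaussBonnet_eq (RiemGeom.frame n x) hB hk2
    rw [RiemGeom.sigma, RiemGeom.gaussBonnet, h.sigma_eq _ hn hB, h1, mul_pos_iff_of_pos_left hc]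
  · obtain ⟨B, hB, h⟩ := key x
    exact h.einsteinLovelock_pos _ hB hk2 hpos hr hv
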